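/- Consider the non-stationary dueling bandits problem with $K\ge 2$ arms, horizon $T$ and $M\ge 2$ stationary segments $S_1,\dots,S_M$ that partition $\{1,\dots,T\}$ into consecutive intervals. In segment $S_m$ a duel of the arms $(i,j)$ is won by $i$ with probability $p^{(m)}_{i,j}\in[0,1]$, independently of everything else, where $p^{(m)}_{i,j}+p^{(m)}_{j,i}=1$, and there is a Condorcet winner $m^*$, i.e. $p^{(m)}_{m^*,i}>\tfrac12$ for all $i\ne m^*$. Playing $(i,j)$ in $S_m$ costs the binary strong regret $\lceil(\Delta^{(m)}_i+\Delta^{(m)}_j)/2\rceil$ with $\Delta^{(m)}_i=p^{(m)}_{m^*,i}-\tfrac12$. Let $\delta=\min_{m<M}\max_{i,j}|p^{(m+1)}_{i,j}-p^{(m)}_{i,j}|$ be the minimal segmental change, and suppose $\delta>0$. The meta-algorithm MDB (Monitored Dueling Bandits) with even window length $w$, threshold $b$, exploration rate $\gamma$, a black-box (possibly randomized) dueling bandits algorithm $Alg$, and an arbitrary ordering $O$ (counted from $0$) of the pairs $(i,j)$ with $i<j$ works as follows. Initially $\tau=0$. In step $t=1,\dots,T$ put $r=(t-\tau-1)\bmod\lfloor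 K(K-1)/(2\gamma)\rfloor$. If $r<K(K-1)/2$, the $r$-th pair of $O$ is played and the outcome is recorded for that pair; if the pair now has at least $w$ recorded outcomes and the numbers of wins in the older and the newer half of its last $w$ recorded outcomes differ by more than $b$ in absolute value, then $\tau$ is set to $t$, all records are emptied and $Alg$ is reset to its initial state. Otherwise the pair chosen by $Alg$ is played and the outcome is fed to $Alg$ only. Let $\mathbb E[R(T)]$ be the expected cumulative binary strong regret of MDB, and let $R_M(Alg)$ be the sum over $m$ of the expected cumulative binary strong regret that $Alg$ incurs when it is started afresh and run on its own for $|S_m|$ steps with the preferences of $S_m$. Set $C=\log\frac{\sqrt{2T}(2T+1)}{\sqrt M K}$, let $w$ be the smallest even integer $w\ge 0$ with $w\ge 8C/\delta^2$, and put $\gamma=(K-1)\sqrt{Mw/(8T)}$, $b=\sqrt{wC/2}$, $c=\sqrt{2C/w}$. Assume that $|S_m|\ge 2L$ for all $m$, where $L=w\lfloor K(K-1)/(2\gamma)\rfloor$, and that $\gamma\in\left[\frac{K(K-1)}{2T},\frac{K-1}{2}\right]$. Then $b,c>0$ and $\delta\ge\frac{2b}{w}+c$, and $$\mathbb E[R(T)]\le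 A\cdot\frac{K\sqrt{MTC}}{\delta}+R_M(Alg)$$ with a universal constant $A$. Moreover, $$\mathbb E[R(T)]=\mathcal O\!\left(\frac{K\sqrt{MT\log(\delta T/(KM))}}{\delta}\right)+R_M(Alg)$$ in the following sense: for every $\varepsilon>0$ there is a constant $B_\varepsilon$, depending on $\varepsilon$ only, such that whenever $\delta T/(KM)\ge T^{\varepsilon}$, $$\mathbb E[R(T)]\le B_\varepsilon\cdot\frac{K\sqrt{MT\log(\delta T/(KM))}}{\delta}+R_M(Alg).$$ (For fixed $K$, $M$, $\delta$ and $\varepsilon=\tfrac12$ the condition holds for all sufficiently large $T$, so the bound holds as $T\to\infty$ with a universal constant.) -/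

import Mathlib

/-- The Bernoulli law on `Bool` with success probability `p`. -/
noncomputable def bernoulliLaw (p : ℝ) (hp : p ∈ Set.Icc (0 : ℝ) 1) : PMF Bool :=
  PMF.ofFintype (fun x => ENNReal.ofReal (if x then p else 1 - p)) (by
    rw [Fintype.sum_bool, if_pos rfl, if_neg (by decide),
      ← ENNReal.ofReal_add hp.1 (sub_nonneg.2 hp.2), add_sub_cancel, ENNReal.ofReal_one])

/-- The expectation of a real function under a discrete law.  It is only used below for laws of
finite support. -/
noncomputable def expectation {α : Type*} (μ : PMF α) (f : α → ℝ) : ℝ :=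
  ∑' a, (μ a).toReal * f a

/-- A non-stationary dueling bandits problem with `K` arms, horizon `T`, and `N` changepoints,
hence with `M = N + 1` stationary segments, which are indexed by `Fin (N + 1)`. The changepoints
`ν_1 < ... < ν_{M-1}` are the values of `changepoint`. -/
structure DuelingEnv (K T N : ℕ) where
  changepoint : Fin N → ℕ
  changepoint_strictMono : StrictMono changepoint
  one_lt_changepoint : ∀ k, 1 < changepoint k
  changepoint_le : ∀ k, changepoint k ≤ T
  /-- `P m i j` is the probability that arm `i` wins against arm `j` in segment `m`. -/
  P : Fin (N + 1) → Fin K → Fin K → ℝ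
  P_mem : ∀ m i j, P m i j ∈ Set.Icc (0 : ℝ) 1
  P_add : ∀ m i j, P m i j + P m j i = 1
  /-- The Condorcet winner of each segment. -/
  cw : Fin (N + 1) → Fin K
  half_lt_cw : ∀ m i, i ≠ cw m → 1 / 2 < P m (cw m) i

namespace DuelingEnv

variable {K T N : ℕ} (E : DuelingEnv K T N)

/-- The segment containing time step `t`: the number of changepoints that are at most `t`. -/
def segment (t : ℕ) : Fin (N + 1) :=
  ⟨(Finset.univ.filter fun k : Fin N => E.changepoint k ≤ t).card,
    Nat.lt_succ_of_le ((Finset.card_le_univ _).trans_eq (Fintype.card_fin N))⟩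

/-- The length `|S_m|`: the number of time steps `1 ≤ t ≤ T` in segment `m`. -/
def segmentLength (m : Fin (N + 1)) : ℕ :=
  ((Finset.Icc 1 T).filter fun t => E.segment t = m).card

/-- The suboptimality gap of arm `i` in segment `m`. -/
noncomputable def gap (m : Fin (N + 1)) (i : Fin K) : ℝ := E.P m (E.cw m) i - 1 / 2

/-- The instantaneous binary strong regret of a pair of arms in segment `m`. -/
noncomputable def binaryStrongRegret (m : Fin (N + 1)) (a : Fin K × Fin K) : ℤ :=
  ⌈(E.gap m a.1 + E.gap m a.2) / 2⌉

/-- The change at the changepoint between the segments `k` and `k + 1`: the maximal absolute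
change of an entry of the preference matrix. -/
noncomputable def segmentalChange (k : Fin N) : ℝ :=
  ⨆ a : Fin K × Fin K, |E.P k.succ a.1 a.2 - E.P k.castSucc a.1 a.2|

/-- The minimal segmental change `δ`. -/
noncomputable def minimalChange : ℝ := ⨅ k : Fin N, E.segmentalChange k

/-- The law of the outcome of a duel in segment `m`; `true` means that the first arm wins. -/
noncomputable def duel (m : Fin (N + 1)) (a : Fin K × Fin K) : PMF Bool :=
  bernoulliLaw (E.P m a.1 a.2) (E.P_mem m a.1 a.2)

end DuelingEnv

/-- What a dueling bandits algorithm has seen since it was started: the played pairs with the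
outcomes of the duels, latest first. -/
abbrev DuelHistory (K : ℕ) : Type := List ((Fin K × Fin K) × Bool)

/-- A (randomized) dueling bandits algorithm: it chooses the next pair of arms at random, with a
law determined by what it has observed since it was started.  Resetting it empties its history. -/
abbrev DuelingAlg (K : ℕ) : Type := DuelHistory K → PMF (Fin K × Fin K)

/-- The pairs of arms `(a_i, a_j)` with `i < j`. -/
abbrev ArmPair (K : ℕ) : Type := {a : Fin K × Fin K // a.1 < a.2}

namespace DuelingEnv

variable {K T N : ℕ} (E : DuelingEnv K T N)

/-- The joint law of the history and the cumulative binary strong regret of `alg` when it is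
started afresh and run on its own for `n` time steps with the preferences of segment `m`. -/
noncomputable def algLaw (alg : DuelingAlg K) (m : Fin (N + 1)) :
    ℕ → PMF (DuelHistory K × ℤ)
  | 0 => PMF.pure ([], 0)
  | n + 1 =>
    (algLaw alg m n).bind fun s =>
    (alg s.1).bind fun a =>
    (E.duel m a).map fun x => ((a, x) :: s.1, s.2 + E.binaryStrongRegret m a)

/-- The sum over all segments of the expected cumulative binary strong regret that `alg` incurs
when it is run on its own, freshly started, on that segment. -/
noncomputable def algRegret (alg : DuelingAlg K) : ℝ :=
  ∑ m : Fin (N + 1), expectation (E.algLaw alg m (E.segmentLength m)) fun s => (s.2 : ℝ)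

end DuelingEnv

/-- The state of MDB: the time `τ` of the last detection, the outcomes of the detection steps of
each pair since then (latest first, so `n_{i,j}` is the length of the list), and the history of
the black-box algorithm since then. -/
structure MDBState (K : ℕ) where
  τ : ℕ
  obs : ArmPair K → List Bool
  hist : DuelHistory K

/-- The state of MDB after a (re)start, the last detection being at time `τ`. -/
def MDBState.fresh (K τ : ℕ) : MDBState K := ⟨τ, fun _ => [], []⟩

/-- The number of time steps in a cycle of MDB with exploration rate `γ`. -/
noncomputable def mdbCycle (K : ℕ) (γ : ℝ) : ℕ := ⌊(K : ℝ) * (K - 1) / (2 * γ)⌋₊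

/-- The changepoint test on a list of outcomes (latest first): there are at least `w` of them, and
the numbers of wins in the older and the newer half of the last `w` differ by more than `b`. -/
def mdbAlarm (w : ℕ) (b : ℝ) (l : List Bool) : Prop :=
  w ≤ l.length ∧
    b < |((((l.drop (w / 2)).take (w / 2)).count true : ℕ) : ℝ) -
          (((l.take (w / 2)).count true : ℕ) : ℝ)|

namespace DuelingEnv

variable {K T N : ℕ} (E : DuelingEnv K T N)

open Classical in
/-- Time step `t` of MDB in state `s`, with window length `w`, threshold `b`, exploration rate `γ`
and ordering `O` of the pairs: the joint law of the next state and of the pair played. -/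
noncomputable def mdbStep (O : Fin (K * (K - 1) / 2) ≃ ArmPair K) (w : ℕ) (b γ : ℝ)
    (alg : DuelingAlg K) (t : ℕ) (s : MDBState K) : PMF (MDBState K × (Fin K × Fin K)) :=
  if h : (t - s.τ - 1) % mdbCycle K γ < K * (K - 1) / 2 then
    let a : ArmPair K := O ⟨(t - s.τ - 1) % mdbCycle K γ, h⟩
    (E.duel (E.segment t) a.1).map fun x =>
      (if mdbAlarm w b (x :: s.obs a) then MDBState.fresh K t
        else { s with obs := Function.update s.obs a (x :: s.obs a) }, a.1)
  else
    (alg s.hist).bind fun a =>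
    (E.duel (E.segment t) a).map fun x => ({ s with hist := (a, x) :: s.hist }, a)

/-- The joint law of the state and the cumulative binary strong regret of MDB after the time
steps `1, ..., n`. -/
noncomputable def mdbLaw (O : Fin (K * (K - 1) / 2) ≃ ArmPair K) (w : ℕ) (b γ : ℝ)
    (alg : DuelingAlg K) : ℕ → PMF (MDBState K × ℤ)
  | 0 => PMF.pure (MDBState.fresh K 0, 0)
  | n + 1 =>
    (mdbLaw O w b γ alg n).bind fun s =>
    (E.mdbStep O w b γ alg (n + 1) s.1).map fun q =>
      (q.1, s.2 + E.binaryStrongRegret (E.segment (n + 1)) q.2)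

/-- The expected cumulative binary strong regret of MDB over the horizon `T`. -/
noncomputable def mdbRegret (O : Fin (K * (K - 1) / 2) ≃ ArmPair K) (w : ℕ) (b γ : ℝ)
    (alg : DuelingAlg K) : ℝ :=
  expectation (E.mdbLaw O w b γ alg T) fun s => (s.2 : ℝ)

end DuelingEnv

/-!
Follow the state of MDB through the value function `mdbRegretFrom`, the expected remaining regret.
Against the value of the black-box algorithm, each step of MDB costs at most `1` more when it is a
detection step, and nothing more otherwise, up to the rare event of an alarm. These costs form a
potential (`monitoringCost`) attached to the record of each pair, and one backward induction over
the time steps shows that the potential dominates the excess regret.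

Inside a stationary segment a false alarm, which may cost the whole horizon `T`, has probability at
most `2 exp (-h c ^ 2)` per detection step by the Chernoff bound for the difference of two
binomials with `h = w / 2` trials each. At a changepoint, some pair changes by at least
`δ ≥ 2 c`, so the first `h` outcomes of that pair in the new segment raise an alarm up to
probability `exp (-h c ^ 2)`, which costs a delay of `h` cycles. A backward induction over the
segments adds this up, and the choice of the parameters makes exploration and delay
`O(K √(M T C) / δ)`, whereas `exp (-h c ^ 2) = exp (-C)` makes the failures negligible.
-/

section Expectation

variable {α β : Type*} {μ : PMF α} {κ : α → PMF β}

theorem expectation_eq_sum {S : Finset α} (hS : μ.support ⊆ S) (f : α → ℝ) :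
    expectation μ f = ∑ a ∈ S, (μ a).toReal * f a := by
  refine tsum_eq_sum fun a ha => ?_
  rw [(PMF.apply_eq_zero_iff μ a).2 fun h => ha (hS h), ENNReal.toReal_zero, zero_mul]

theorem expectation_pure (a : α) (f : α → ℝ) : expectation (PMF.pure a) f = f a := by
  rw [expectation_eq_sum (S := {a}) (by simp)]
  simp

theorem expectation_const (μ : PMF α) (c : ℝ) : expectation μ (fun _ => c) = c := by
  rw [expectation, tsum_mul_right, ← ENNReal.tsum_toReal_eq μ.apply_ne_top, μ.tsum_coe,
    ENNReal.toReal_one, one_mul]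

theorem expectation_const_mul (μ : PMF α) (c : ℝ) (f : α → ℝ) :
    expectation μ (fun a => c * f a) = c * expectation μ f := by
  simp only [expectation, ← tsum_mul_left, mul_left_comm]

theorem expectation_add (hμ : μ.support.Finite) (f g : α → ℝ) :
    expectation μ (fun a => f a + g a) = expectation μ f + expectation μ g := by
  have hS : μ.support ⊆ hμ.toFinset := hμ.coe_toFinset.ge
  simp only [expectation_eq_sum hS, mul_add, Finset.sum_add_distrib]

theorem expectation_const_add (hμ : μ.support.Finite) (c : ℝ) (f : α → ℝ) :
    expectation μ (fun a => c + f a) = c + expectation μ f := by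
  rw [expectation_add hμ, expectation_const]

theorem expectation_sum (hμ : μ.support.Finite) {ι : Type*} (s : Finset ι) (f : ι → α → ℝ) :
    expectation μ (fun a => ∑ i ∈ s, f i a) = ∑ i ∈ s, expectation μ (f i) := by
  have hS : μ.support ⊆ hμ.toFinset := hμ.coe_toFinset.ge
  simp only [expectation_eq_sum hS, Finset.mul_sum]
  exact Finset.sum_comm

theorem expectation_mono (hμ : μ.support.Finite) {f g : α → ℝ} (h : ∀ a, f a ≤ g a) :
    expectation μ f ≤ expectation μ g := by
  have hS : μ.support ⊆ hμ.toFinset := hμ.coe_toFinset.ge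
  rw [expectation_eq_sum hS, expectation_eq_sum hS]
  exact Finset.sum_le_sum fun a _ => mul_le_mul_of_nonneg_left (h a) ENNReal.toReal_nonneg

theorem expectation_nonneg (μ : PMF α) {f : α → ℝ} (h : ∀ a, 0 ≤ f a) : 0 ≤ expectation μ f :=
  tsum_nonneg fun a => mul_nonneg ENNReal.toReal_nonneg (h a)

theorem toReal_bind_apply {S : Finset α} (hS : μ.support ⊆ S) (κ : α → PMF β) (b : β) :
    (μ.bind κ b).toReal = ∑ a ∈ S, (μ a).toReal * (κ a b).toReal := by
  rw [PMF.bind_apply, tsum_eq_sum (s := S), ENNReal.toReal_sum]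
  · simp only [ENNReal.toReal_mul]
  · exact fun a _ => ENNReal.mul_ne_top (μ.apply_ne_top a) ((κ a).apply_ne_top b)
  · intro a ha
    rw [(PMF.apply_eq_zero_iff μ a).2 fun h => ha (hS h), zero_mul]

theorem expectation_bind (hμ : μ.support.Finite) (hκ : ∀ a, (κ a).support.Finite) (f : β → ℝ) :
    expectation (μ.bind κ) f = expectation μ fun a => expectation (κ a) f := by
  classical
  set S := hμ.toFinset
  set U := S.biUnion fun a => (hκ a).toFinset
  have hS : μ.support ⊆ S := hμ.coe_toFinset.ge
  have hκU : ∀ a ∈ S, (κ a).support ⊆ U := fun a ha b hb =>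
    Finset.mem_biUnion.2 ⟨a, ha, (hκ a).mem_toFinset.2 hb⟩
  have hbU : (μ.bind κ).support ⊆ U := fun b hb => by
    obtain ⟨a, ha, hb⟩ := (PMF.mem_support_bind_iff _ _ _).1 hb
    exact hκU a (hS ha) hb
  rw [expectation_eq_sum hbU, expectation_eq_sum hS]
  simp only [toReal_bind_apply hS, Finset.sum_mul]
  rw [Finset.sum_comm]
  refine Finset.sum_congr rfl fun a ha => ?_
  rw [expectation_eq_sum (hκU a ha), Finset.mul_sum]
  exact Finset.sum_congr rfl fun b _ => mul_assoc _ _ _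

theorem expectation_map (hμ : μ.support.Finite) (g : α → β) (f : β → ℝ) :
    expectation (μ.map g) f = expectation μ fun a => f (g a) := by
  rw [← PMF.bind_pure_comp, expectation_bind hμ fun a => by simp]
  simp only [Function.comp_apply, expectation_pure]

theorem finite_support_bind (hμ : μ.support.Finite) (hκ : ∀ a, (κ a).support.Finite) :
    (μ.bind κ).support.Finite := by
  rw [PMF.support_bind]
  exact hμ.biUnion fun a _ => hκ a

theorem finite_support_map (hμ : μ.support.Finite) (g : α → β) : (μ.map g).support.Finite := by
  rw [PMF.support_map]
  exact hμ.image g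

theorem expectation_eq_integral [Finite α] [MeasurableSpace α] [MeasurableSingletonClass α]
    (μ : PMF α) (f : α → ℝ) : expectation μ f = ∫ a, f a ∂μ.toMeasure := by
  cases nonempty_fintype α
  rw [PMF.integral_eq_sum, expectation_eq_sum (S := Finset.univ) (by simp)]
  rfl

end Expectation

section IndependentDraws

variable {μ ν : PMF Bool}

/-- The expectation of `f` at the list that results from `l` by putting `n` independent draws
from `μ` in front of it, latest first. -/
noncomputable def expectationAfter (μ : PMF Bool) : ℕ → (List Bool → ℝ) → List Bool → ℝ
  | 0, f, l => f l
  | n + 1, f, l => expectation μ fun x => expectationAfter μ n f (x :: l)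

theorem expectationAfter_mono {n : ℕ} {f g : List Bool → ℝ} {l : List Bool}
    (hfg : ∀ v : List Bool, v.length = n → f (v ++ l) ≤ g (v ++ l)) :
    expectationAfter μ n f l ≤ expectationAfter μ n g l := by
  induction n generalizing l with
  | zero => exact hfg [] rfl
  | succ n ih =>
    refine expectation_mono (Set.toFinite _) fun x => ih fun v hv => ?_
    simpa using hfg (v ++ [x]) (by simp [hv])

theorem expectationAfter_const (μ : PMF Bool) (n : ℕ) (c : ℝ) (l : List Bool) :
    expectationAfter μ n (fun _ => c) l = c := by
  induction n generalizing l with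
  | zero => rfl
  | succ n ih => simp only [expectationAfter, ih, expectation_const]

theorem expectationAfter_le {n : ℕ} {f : List Bool → ℝ} {l : List Bool} {c : ℝ}
    (hf : ∀ v : List Bool, v.length = n → f (v ++ l) ≤ c) : expectationAfter μ n f l ≤ c :=
  (expectationAfter_mono hf).trans_eq (expectationAfter_const μ n c l)

theorem expectationAfter_nonneg (μ : PMF Bool) (n : ℕ) {f : List Bool → ℝ} (hf : ∀ l, 0 ≤ f l)
    (l : List Bool) : 0 ≤ expectationAfter μ n f l :=
  (expectationAfter_const μ n 0 l).ge.trans (expectationAfter_mono fun v _ => hf (v ++ l))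

theorem expectationAfter_add_fun (μ : PMF Bool) (n : ℕ) (f g : List Bool → ℝ) (l : List Bool) :
    expectationAfter μ n (fun v => f v + g v) l =
      expectationAfter μ n f l + expectationAfter μ n g l := by
  induction n generalizing l with
  | zero => rfl
  | succ n ih => simp only [expectationAfter, ih, expectation_add (Set.toFinite μ.support)]

theorem expectationAfter_const_mul (μ : PMF Bool) (n : ℕ) (c : ℝ) (f : List Bool → ℝ)
    (l : List Bool) :
    expectationAfter μ n (fun v => c * f v) l = c * expectationAfter μ n f l := by
  induction n generalizing l with
  | zero => rfl
  | succ n ih => simp only [expectationAfter, ih, expectation_const_mul]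

theorem expectationAfter_add (μ : PMF Bool) (m n : ℕ) (f : List Bool → ℝ) (l : List Bool) :
    expectationAfter μ (m + n) f l = expectationAfter μ m (expectationAfter μ n f) l := by
  induction m generalizing l with
  | zero => rw [Nat.zero_add]; rfl
  | succ m ih => simp only [Nat.add_right_comm m 1 n, expectationAfter, ih]

theorem expectationAfter_append (μ : PMF Bool) (n : ℕ) (f : List Bool → ℝ) (l₁ l₂ : List Bool) :
    expectationAfter μ n f (l₁ ++ l₂) = expectationAfter μ n (fun v => f (v ++ l₂)) l₁ := by
  induction n generalizing l₁ with
  | zero => rfl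
  | succ n ih => simp only [expectationAfter, ← List.cons_append, ih]

theorem expectationAfter_eq_nil (μ : PMF Bool) (n : ℕ) (f : List Bool → ℝ) (l : List Bool) :
    expectationAfter μ n f l = expectationAfter μ n (fun v => f (v ++ l)) [] :=
  expectationAfter_append μ n f [] l

theorem expectation_exp_le (μ : PMF Bool) (t : ℝ) :
    expectation μ (fun x => Real.exp (t * x.toNat)) ≤
      Real.exp (t * (μ true).toReal + t ^ 2 / 8) := by
  have hmem : ∀ x : Bool, ((x.toNat : ℕ) : ℝ) ∈ Set.Icc (0 : ℝ) 1 := by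
    rintro (_ | _) <;> simp
  have hmean : ∫ x, ((x.toNat : ℕ) : ℝ) ∂μ.toMeasure = (μ true).toReal := by
    simp [PMF.integral_eq_sum]
  have hoeffding := (ProbabilityTheory.hasSubgaussianMGF_of_mem_Icc (μ := μ.toMeasure)
    (Measurable.of_discrete (f := fun x : Bool => ((x.toNat : ℕ) : ℝ))).aemeasurable
    (Filter.Eventually.of_forall hmem)).mgf_le t
  simp only [sub_eq_add_neg, hmean, ProbabilityTheory.mgf_add_const] at hoeffding
  calc expectation μ (fun x => Real.exp (t * x.toNat))
      = ProbabilityTheory.mgf (fun x : Bool => ((x.toNat : ℕ) : ℝ)) μ.toMeasure t *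
          Real.exp (t * -(μ true).toReal) * Real.exp (t * (μ true).toReal) := by
        rw [mul_assoc, ← Real.exp_add, expectation_eq_integral, ProbabilityTheory.mgf]
        simp
    _ ≤ _ := by
        refine (mul_le_mul_of_nonneg_right hoeffding (Real.exp_pos _).le).trans_eq ?_
        rw [← Real.exp_add]
        congr 1
        simp only [neg_zero, add_zero, nnnorm_one, one_div, inv_pow, NNReal.coe_inv,
          NNReal.coe_pow, NNReal.coe_ofNat]
        ring

theorem expectationAfter_exp_count_le (μ : PMF Bool) (n : ℕ) (t : ℝ) (l : List Bool) :
    expectationAfter μ n (fun v => Real.exp (t * v.count true)) l ≤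
      Real.exp (n * (t * (μ true).toReal + t ^ 2 / 8) + t * l.count true) := by
  induction n generalizing l with
  | zero => simp [expectationAfter]
  | succ n ih =>
    have hcount : ∀ x : Bool, ((x :: l).count true : ℝ) = x.toNat + l.count true := by
      rintro (_ | _) <;> simp [add_comm]
    calc expectationAfter μ (n + 1) (fun v => Real.exp (t * v.count true)) l
        ≤ expectation μ fun x => Real.exp (n * (t * (μ true).toReal + t ^ 2 / 8) +
            t * l.count true) * Real.exp (t * x.toNat) := by
          refine expectation_mono (Set.toFinite _) fun x => (ih (x :: l)).trans_eq ?_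
          rw [hcount, ← Real.exp_add]
          ring_nf
      _ ≤ _ := by
          rw [expectation_const_mul]
          refine (mul_le_mul_of_nonneg_left (expectation_exp_le μ t) (Real.exp_pos _).le).trans_eq
            ?_
          rw [← Real.exp_add]
          push_cast
          ring_nf

theorem expectationAfter_exp_count_sub_count_le (μ ν : PMF Bool) (h : ℕ) (t a : ℝ) :
    expectationAfter μ h (fun v => expectationAfter ν h (fun u =>
        Real.exp (t * ((v.count true : ℝ) - u.count true) - a)) []) [] ≤
      Real.exp (h * (t * ((μ true).toReal - (ν true).toReal) + t ^ 2 / 4) - a) := by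
  calc _ = expectationAfter μ h (fun v =>
          expectationAfter ν h (fun u => Real.exp (-t * u.count true)) [] * Real.exp (-a) *
            Real.exp (t * v.count true)) [] := by
        congr 1
        funext v
        rw [mul_assoc, mul_comm, ← expectationAfter_const_mul]
        congr 1
        funext u
        rw [← Real.exp_add, ← Real.exp_add]
        ring_nf
    _ ≤ Real.exp (h * (-t * (ν true).toReal + (-t) ^ 2 / 8) + -t * ([] : List Bool).count true) *
          Real.exp (-a) *
          Real.exp (h * (t * (μ true).toReal + t ^ 2 / 8) + t * ([] : List Bool).count true) := by
        have hν := expectationAfter_exp_count_le ν h (-t) []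
        have hμ := expectationAfter_exp_count_le μ h t []
        have hμ0 := expectationAfter_nonneg μ h
          (fun v => (Real.exp_pos (t * v.count true)).le) []
        rw [expectationAfter_const_mul]
        gcongr
    _ = _ := by
        rw [← Real.exp_add, ← Real.exp_add]
        simp only [List.count_nil, Nat.cast_zero]
        ring_nf

theorem mdbAlarm_append_iff {h : ℕ} {u v : List Bool} (hu : u.length = h) (hv : v.length = h)
    (b : ℝ) (l : List Bool) :
    mdbAlarm (2 * h) b (u ++ (v ++ l)) ↔ b < |(v.count true : ℝ) - u.count true| := by
  subst hu
  rw [mdbAlarm, Nat.mul_div_cancel_left _ two_pos, List.take_left, List.drop_left,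
    List.take_left' hv]
  exact and_iff_right (by simp only [List.length_append, hv]; omega)

open Classical in
theorem expectationAfter_lt_abs_count_sub_count_le (μ : PMF Bool) (h : ℕ) {c : ℝ} (hc : 0 ≤ c) :
    expectationAfter μ h (fun v => expectationAfter μ h (fun u =>
        if h * c < |(v.count true : ℝ) - u.count true| then 1 else 0) []) [] ≤
      2 * Real.exp (-(h * c ^ 2)) := by
  set E : ℝ → List Bool → List Bool → ℝ := fun t v u =>
    Real.exp (t * ((v.count true : ℝ) - u.count true) - 2 * c * (h * c))
  have markov : ∀ v u : List Bool,
      (if h * c < |(v.count true : ℝ) - u.count true| then 1 else 0) ≤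
        E (2 * c) v u + E (-(2 * c)) v u := by
    intro v u
    have hpos : ∀ t, 0 ≤ E t v u := fun t => (Real.exp_pos _).le
    split_ifs with hX
    · rcases lt_abs.1 hX with hX | hX
      · exact (Real.one_le_exp (by nlinarith)).trans (le_add_of_nonneg_right (hpos _))
      · exact (Real.one_le_exp (by nlinarith)).trans (le_add_of_nonneg_left (hpos _))
    · exact add_nonneg (hpos _) (hpos _)
  calc _ ≤ expectationAfter μ h (fun v => expectationAfter μ h (E (2 * c) v) [] +
            expectationAfter μ h (E (-(2 * c)) v) []) [] := by
        refine expectationAfter_mono fun v _ => ?_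
        rw [← expectationAfter_add_fun]
        exact expectationAfter_mono fun u _ => markov _ _
    _ ≤ _ := by
        rw [expectationAfter_add_fun, two_mul]
        refine (add_le_add (expectationAfter_exp_count_sub_count_le μ μ h _ _)
          (expectationAfter_exp_count_sub_count_le μ μ h _ _)).trans_eq ?_
        ring_nf

open Classical in
theorem expectationAfter_abs_count_sub_count_le_le {h : ℕ} {c : ℝ} (hc : 0 ≤ c)
    (hgap : 2 * c ≤ |(μ true).toReal - (ν true).toReal|) :
    expectationAfter μ h (fun v => expectationAfter ν h (fun u =>
        if h * c < |(v.count true : ℝ) - u.count true| then 0 else 1) []) [] ≤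
      Real.exp (-(h * c ^ 2)) := by
  obtain ⟨t, ht, hdrift⟩ : ∃ t : ℝ, |t| = 2 * c ∧
      t * ((μ true).toReal - (ν true).toReal) ≤ -(2 * c * (2 * c)) := by
    have h2c : |2 * c| = 2 * c := abs_of_nonneg (by positivity)
    rcases le_abs.1 hgap with hgap | hgap
    · exact ⟨-(2 * c), (abs_neg _).trans h2c, by nlinarith⟩
    · exact ⟨2 * c, h2c, by nlinarith⟩
  have markov : ∀ v u : List Bool,
      (if h * c < |(v.count true : ℝ) - u.count true| then 0 else 1) ≤
        Real.exp (t * ((v.count true : ℝ) - u.count true) - -(2 * c * (h * c))) := by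
    intro v u
    split_ifs with hX
    · positivity
    · have hbound : |t * ((v.count true : ℝ) - u.count true)| ≤ 2 * c * (h * c) := by
        rw [abs_mul, ht]
        exact mul_le_mul_of_nonneg_left (not_lt.1 hX) (by positivity)
      exact Real.one_le_exp (by linarith [neg_le_of_abs_le hbound])
  refine le_trans (expectationAfter_mono fun v _ => expectationAfter_mono fun u _ => ?_)
    ((expectationAfter_exp_count_sub_count_le μ ν h t (-(2 * c * (h * c)))).trans
      (Real.exp_le_exp.2 ?_))
  · simpa only [List.append_nil] using markov v u
  · have hdrift_mul := mul_le_mul_of_nonneg_left hdrift (Nat.cast_nonneg (α := ℝ) h)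
    rw [← sq_abs t, ht]
    linarith

open Classical in
theorem expectationAfter_alarm_le (μ : PMF Bool) (n h : ℕ) {c : ℝ} (hc : 0 ≤ c) :
    expectationAfter μ n (fun l => if mdbAlarm (2 * h) (h * c) l then 1 else 0) [] ≤
      2 * Real.exp (-(h * c ^ 2)) := by
  rcases lt_or_ge n (2 * h) with hn | hn
  · refine expectationAfter_le fun v hv => ?_
    have hshort : ¬ mdbAlarm (2 * h) (h * c) v := fun hl => (hv.symm ▸ hn).not_ge hl.1
    rw [List.append_nil, if_neg hshort]
    positivity
  obtain ⟨m, rfl⟩ := Nat.exists_eq_add_of_le' hn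
  rw [two_mul, expectationAfter_add]
  refine expectationAfter_le fun l _ => ?_
  rw [List.append_nil, expectationAfter_add, expectationAfter_eq_nil, ← two_mul]
  simp only [expectationAfter_eq_nil μ h _ (_ ++ l)]
  refine le_trans (expectationAfter_mono fun v hv => expectationAfter_mono fun u hu => ?_)
    (expectationAfter_lt_abs_count_sub_count_le μ h hc)
  simp only [List.append_nil, mdbAlarm_append_iff hu hv, le_refl]

open Classical in
theorem expectationAfter_not_alarm_le {n h : ℕ} (hn : h ≤ n) {c : ℝ} (hc : 0 ≤ c)
    (hgap : 2 * c ≤ |(μ true).toReal - (ν true).toReal|) :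
    expectationAfter μ n
        (expectationAfter ν h fun l => if mdbAlarm (2 * h) (h * c) l then 0 else 1) [] ≤
      Real.exp (-(h * c ^ 2)) := by
  obtain ⟨m, rfl⟩ := Nat.exists_eq_add_of_le' hn
  rw [expectationAfter_add]
  refine expectationAfter_le fun l _ => ?_
  rw [List.append_nil, expectationAfter_eq_nil]
  simp only [expectationAfter_eq_nil ν h _ (_ ++ l)]
  refine le_trans (expectationAfter_mono fun v hv => expectationAfter_mono fun u hu => ?_)
    (expectationAfter_abs_count_sub_count_le_le hc hgap)
  simp only [List.append_nil, mdbAlarm_append_iff hu hv, le_refl]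

end IndependentDraws

section MonitoringCost

variable {μ ν : PMF Bool} {w : ℕ} {b σ ρ : ℝ} {f : List Bool → ℝ}

open Classical in
/-- The expected cost of monitoring one pair for `n` detection steps that start with the record `l`
and have independent outcomes of law `μ`: a step costs `σ`, an alarm costs `ρ` and stops the
monitoring, and if there is none, then `f` is paid at the final record. -/
noncomputable def monitoringCost (μ : PMF Bool) (w : ℕ) (b σ ρ : ℝ) (f : List Bool → ℝ) :
    ℕ → List Bool → ℝ
  | 0, l => f l
  | n + 1, l => σ + expectation μ fun x =>
      if mdbAlarm w b (x :: l) then ρ else monitoringCost μ w b σ ρ f n (x :: l)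

theorem monitoringCost_nonneg (hσ : 0 ≤ σ) (hρ : 0 ≤ ρ) (hf : ∀ l, 0 ≤ f l) (n : ℕ)
    (l : List Bool) : 0 ≤ monitoringCost μ w b σ ρ f n l := by
  induction n generalizing l with
  | zero => exact hf l
  | succ n ih =>
    refine add_nonneg hσ (expectation_nonneg μ fun x => ?_)
    split_ifs
    exacts [hρ, ih _]

theorem monitoringCost_zero (μ : PMF Bool) (w : ℕ) (b : ℝ) (n : ℕ) (l : List Bool) :
    monitoringCost μ w b 0 0 (fun _ => 0) n l = 0 := by
  induction n generalizing l with
  | zero => rfl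
  | succ n ih => simp only [monitoringCost, ih, ite_self, expectation_const, add_zero]

open Classical in
theorem monitoringCost_le_add_sum (hσ : 0 ≤ σ) (hρ : 0 ≤ ρ) (hf : ∀ l, 0 ≤ f l) (n : ℕ)
    (l : List Bool) :
    monitoringCost μ w b σ ρ f n l ≤ expectationAfter μ n f l + n * σ +
      ρ * ∑ j ∈ Finset.range n,
        expectationAfter μ (j + 1) (fun v => if mdbAlarm w b v then 1 else 0) l := by
  induction n generalizing l with
  | zero => simp [monitoringCost, expectationAfter]
  | succ n ih =>
    set A : List Bool → ℝ := fun v => if mdbAlarm w b v then 1 else 0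
    have hA : ∀ j l, 0 ≤ expectationAfter μ j A l := fun j =>
      expectationAfter_nonneg μ j fun v => by positivity
    have hfin : μ.support.Finite := Set.toFinite _
    calc monitoringCost μ w b σ ρ f (n + 1) l
        ≤ σ + expectation μ fun x => expectationAfter μ n f (x :: l) + n * σ +
            ρ * (∑ j ∈ Finset.range n, expectationAfter μ (j + 1) A (x :: l) + A (x :: l)) := by
          refine add_le_add_right (expectation_mono hfin fun x => ?_) σ
          have hfx := expectationAfter_nonneg μ n hf (x :: l)
          have hsum := Finset.sum_nonneg fun j (_ : j ∈ Finset.range n) => hA (j + 1) (x :: l)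
          split_ifs with hx
          · rw [show A (x :: l) = 1 from if_pos hx]
            nlinarith [mul_nonneg (Nat.cast_nonneg (α := ℝ) n) hσ, mul_nonneg hρ hsum]
          · rw [show A (x :: l) = 0 from if_neg hx, add_zero]
            exact ih _
      _ = _ := by
          rw [expectation_add hfin, expectation_add hfin, expectation_const, expectation_const_mul,
            expectation_add hfin, expectation_sum hfin, Finset.sum_range_succ']
          simp only [expectationAfter]
          push_cast
          ring

theorem monitoringCost_nil_le (hσ : 0 ≤ σ) (hρ : 0 ≤ ρ) (hf : ∀ l, 0 ≤ f l) (n h : ℕ) {c : ℝ}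
    (hc : 0 ≤ c) :
    monitoringCost μ (2 * h) (h * c) σ ρ f n [] ≤
      expectationAfter μ n f [] + n * (σ + ρ * (2 * Real.exp (-(h * c ^ 2)))) := by
  refine (monitoringCost_le_add_sum hσ hρ hf n []).trans ?_
  have hsum := Finset.sum_le_card_nsmul (Finset.range n) _ _ fun j _ =>
    expectationAfter_alarm_le μ (j + 1) h hc
  rw [Finset.card_range, nsmul_eq_mul] at hsum
  linarith [mul_le_mul_of_nonneg_left hsum hρ]

open Classical in
theorem monitoringCost_const_le {v : ℝ} (hv : 0 ≤ v) (n : ℕ) (l : List Bool) :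
    monitoringCost μ w b 0 0 (fun _ => v) (n + 1) l ≤
      v * expectationAfter μ (n + 1) (fun l => if mdbAlarm w b l then 0 else 1) l := by
  induction n generalizing l with
  | zero =>
    simp only [monitoringCost, expectationAfter, zero_add, ← expectation_const_mul]
    simp only [mul_ite, mul_zero, mul_one, le_refl]
  | succ n ih =>
    rw [monitoringCost, zero_add, expectationAfter, ← expectation_const_mul]
    refine expectation_mono (Set.toFinite _) fun x => ?_
    split_ifs
    · exact mul_nonneg hv (expectationAfter_nonneg μ _ (fun l => by positivity) _)
    · exact ih _

theorem expectationAfter_monitoringCost_le {n h : ℕ} (hh : 0 < h) (hn : h ≤ n) {c v : ℝ}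
    (hc : 0 ≤ c) (hv : 0 ≤ v) (hgap : 2 * c ≤ |(μ true).toReal - (ν true).toReal|) :
    expectationAfter μ n (monitoringCost ν (2 * h) (h * c) 0 0 (fun _ => v) h) [] ≤
      v * Real.exp (-(h * c ^ 2)) := by
  obtain ⟨k, rfl⟩ := Nat.exists_eq_add_one.2 hh
  refine le_trans ?_ (mul_le_mul_of_nonneg_left (expectationAfter_not_alarm_le hn hc hgap) hv)
  rw [← expectationAfter_const_mul]
  exact expectationAfter_mono fun u _ => monitoringCost_const_le hv k (u ++ [])

end MonitoringCost

section RoundRobin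

/-- The number of times at which the residue class `r` comes up during `x, ..., y - 1` when the
residue classes modulo `cyc` take turns. -/
def visits (cyc r x y : ℕ) : ℕ := ((Finset.Ico x y).filter fun j => j % cyc = r).card

theorem visits_self (cyc r x : ℕ) : visits cyc r x x = 0 := by
  rw [visits, Finset.Ico_self, Finset.filter_empty, Finset.card_empty]

theorem visits_of_mod_eq {cyc r x y : ℕ} (hxy : x < y) (hr : x % cyc = r) :
    visits cyc r x y = visits cyc r (x + 1) y + 1 := by
  rw [visits, ← Finset.insert_Ico_add_one_left_eq_Ico hxy, Finset.filter_insert, if_pos hr,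
    Finset.card_insert_of_notMem (by simp), visits]

theorem visits_of_mod_ne {cyc r x y : ℕ} (hxy : x < y) (hr : x % cyc ≠ r) :
    visits cyc r x y = visits cyc r (x + 1) y := by
  rw [visits, ← Finset.insert_Ico_add_one_left_eq_Ico hxy, Finset.filter_insert, if_neg hr, visits]

theorem visits_add_mul {cyc r : ℕ} (hr : r < cyc) (x n : ℕ) :
    visits cyc r x (x + n * cyc) = n := by
  have hcyc : 0 < cyc := r.zero_le.trans_lt hr
  have hmod : visits cyc r x (x + n * cyc) =
      ((Finset.Ico x (x + n * cyc)).filter fun j => j ≡ r [MOD cyc]).card := by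
    simp only [visits, Nat.ModEq, Nat.mod_eq_of_lt hr]
  have hceil : ((x + n * cyc : ℕ) - r : ℚ) / cyc = (x - r) / cyc + n := by
    push_cast
    field_simp
    ring
  have hcard := Nat.Ico_filter_modEq_card x (x + n * cyc) hcyc r
  rw [hceil, Int.ceil_add_natCast, add_sub_cancel_left, max_eq_left n.cast_nonneg] at hcard
  rw [hmod]
  exact_mod_cast hcard

theorem visits_mono {cyc r x y z : ℕ} (hyz : y ≤ z) : visits cyc r x y ≤ visits cyc r x z :=
  Finset.card_le_card (Finset.filter_subset_filter _ (Finset.Ico_subset_Ico_right hyz))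

theorem visits_zero_le {cyc r : ℕ} (hr : r < cyc) (n : ℕ) : visits cyc r 0 n ≤ n / cyc + 1 := by
  have hn : n ≤ 0 + (n / cyc + 1) * cyc := by
    have := Nat.lt_div_mul_add (r.zero_le.trans_lt hr) (a := n)
    rw [add_one_mul]
    omega
  exact (visits_mono hn).trans_eq (visits_add_mul hr 0 _)

variable {ι : Type*} [Fintype ι] {k : ℕ} {O : Fin k ≃ ι} {cyc w : ℕ} {b σ ρ : ℝ}
  {μ : ι → PMF Bool} {f : ι → List Bool → ℝ} {x y : ℕ} {obs : ι → List Bool}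

/-- The sum of the expected costs of monitoring the pairs `O 0, O 1, ...`, which take turns at the
first steps of each cycle, during the steps `x, ..., y - 1`, starting with the records `obs`. -/
noncomputable def totalMonitoringCost (O : Fin k ≃ ι) (cyc w : ℕ) (b σ ρ : ℝ) (μ : ι → PMF Bool)
    (f : ι → List Bool → ℝ) (x y : ℕ) (obs : ι → List Bool) : ℝ :=
  ∑ a, monitoringCost (μ a) w b σ ρ (f a) (visits cyc (O.symm a) x y) (obs a)

theorem totalMonitoringCost_self :
    totalMonitoringCost O cyc w b σ ρ μ f x x obs = ∑ a, f a (obs a) := by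
  simp only [totalMonitoringCost, visits_self, monitoringCost]

theorem totalMonitoringCost_of_le_mod (hxy : x < y) (hx : k ≤ x % cyc) :
    totalMonitoringCost O cyc w b σ ρ μ f x y obs =
      totalMonitoringCost O cyc w b σ ρ μ f (x + 1) y obs := by
  simp only [totalMonitoringCost, visits_of_mod_ne hxy ((O.symm _).2.trans_le hx).ne']

theorem totalMonitoringCost_nil_le (hσ : 0 ≤ σ) (hρ : 0 ≤ ρ) (hf : ∀ a l, 0 ≤ f a l)
    (hcyc : k ≤ cyc) (n h : ℕ) {c : ℝ} (hc : 0 ≤ c) :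
    totalMonitoringCost O cyc (2 * h) (h * c) σ ρ μ f 0 n (fun _ => []) ≤
      ∑ a, expectationAfter (μ a) (visits cyc (O.symm a) 0 n) (f a) [] +
        k * (n / cyc + 1 : ℕ) * (σ + ρ * (2 * Real.exp (-(h * c ^ 2)))) := by
  have hcard : ((Finset.univ : Finset ι).card : ℝ) = k := by
    rw [Finset.card_univ, ← Fintype.card_congr O, Fintype.card_fin]
  rw [totalMonitoringCost, ← hcard, mul_assoc, ← nsmul_eq_mul (Finset.card _), ← Finset.sum_const,
    ← Finset.sum_add_distrib]
  refine Finset.sum_le_sum fun a _ => (monitoringCost_nil_le hσ hρ (hf a) _ h hc).trans ?_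
  have hvisits := visits_zero_le ((O.symm a).2.trans_le hcyc) n
  gcongr

open Classical in
theorem add_expectation_totalMonitoringCost_le [DecidableEq ι] (hσ : 0 ≤ σ) (hρ : 0 ≤ ρ)
    (hf : ∀ a l, 0 ≤ f a l) (hxy : x < y) {r : Fin k} (hr : x % cyc = r) :
    σ + expectation (μ (O r)) (fun z => if mdbAlarm w b (z :: obs (O r)) then ρ else
        totalMonitoringCost O cyc w b σ ρ μ f (x + 1) y
          (Function.update obs (O r) (z :: obs (O r)))) ≤
      totalMonitoringCost O cyc w b σ ρ μ f x y obs := by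
  set a := O r
  set cost : ι → ℕ → List Bool → ℝ := fun a' => monitoringCost (μ a') w b σ ρ (f a')
  set rest := ∑ a' ∈ Finset.univ.erase a, cost a' (visits cyc (O.symm a') x y) (obs a')
  have hrest : 0 ≤ rest := Finset.sum_nonneg fun a' _ => monitoringCost_nonneg hσ hρ (hf a') _ _
  have hvisits : visits cyc (O.symm a) x y = visits cyc r (x + 1) y + 1 := by
    rw [O.symm_apply_apply, visits_of_mod_eq hxy hr]
  have htotal : totalMonitoringCost O cyc w b σ ρ μ f x y obs =
      cost a (visits cyc r (x + 1) y + 1) (obs a) + rest := by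
    rw [← hvisits]
    exact (Finset.add_sum_erase _ _ (Finset.mem_univ a)).symm
  have hupdate (z : Bool) : totalMonitoringCost O cyc w b σ ρ μ f (x + 1) y
      (Function.update obs a (z :: obs a)) =
        cost a (visits cyc r (x + 1) y) (z :: obs a) + rest := by
    rw [totalMonitoringCost, ← Finset.add_sum_erase _ _ (Finset.mem_univ a), Function.update_self,
      O.symm_apply_apply]
    refine congrArg _ (Finset.sum_congr rfl fun a' ha' => ?_)
    have hne : x % cyc ≠ O.symm a' := fun h => (Finset.mem_erase.1 ha').1
      (O.symm_apply_eq.1 (Fin.ext (h.symm.trans hr)))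
    rw [Function.update_of_ne (Finset.mem_erase.1 ha').1, visits_of_mod_ne hxy hne]
  calc _ ≤ σ + expectation (μ a) (fun z => (if mdbAlarm w b (z :: obs a) then ρ else
            cost a (visits cyc r (x + 1) y) (z :: obs a)) + rest) := by
        refine add_le_add_right (expectation_mono (Set.toFinite _) fun z => ?_) σ
        split_ifs
        · exact le_add_of_nonneg_right hrest
        · exact (hupdate z).le
    _ = cost a (visits cyc r (x + 1) y + 1) (obs a) + rest := by
        rw [expectation_add (Set.toFinite _), expectation_const, ← add_assoc]
        rfl
    _ = _ := htotal.symm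

end RoundRobin

namespace DuelingEnv

variable {K T N : ℕ} (E : DuelingEnv K T N)

theorem toReal_duel_true (m : Fin (N + 1)) (a : Fin K × Fin K) :
    (E.duel m a true).toReal = E.P m a.1 a.2 := by
  simp [duel, bernoulliLaw, ENNReal.toReal_ofReal (E.P_mem m a.1 a.2).1]

theorem gap_mem_Icc (m : Fin (N + 1)) (i : Fin K) : E.gap m i ∈ Set.Icc (0 : ℝ) (1 / 2) := by
  have hle := (E.P_mem m (E.cw m) i).2
  refine ⟨?_, by rw [gap]; linarith⟩
  rw [gap]
  rcases eq_or_ne i (E.cw m) with rfl | hi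
  · linarith [E.P_add m (E.cw m) (E.cw m)]
  · linarith [E.half_lt_cw m i hi]

theorem binaryStrongRegret_nonneg (m : Fin (N + 1)) (a : Fin K × Fin K) :
    (0 : ℝ) ≤ E.binaryStrongRegret m a :=
  Int.cast_nonneg (Int.ceil_nonneg
    (by linarith [(E.gap_mem_Icc m a.1).1, (E.gap_mem_Icc m a.2).1]))

theorem binaryStrongRegret_le_one (m : Fin (N + 1)) (a : Fin K × Fin K) :
    (E.binaryStrongRegret m a : ℝ) ≤ 1 := by
  rw [binaryStrongRegret, ← Int.cast_one, Int.cast_le, Int.ceil_le, Int.cast_one]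
  linarith [(E.gap_mem_Icc m a.1).2, (E.gap_mem_Icc m a.2).2]

section AlgRegretFrom

variable (alg : DuelingAlg K) (m : Fin (N + 1))

/-- The expected binary strong regret of `alg` with history `l` over `n` further time steps with
the preferences of segment `m`. -/
noncomputable def algRegretFrom : ℕ → DuelHistory K → ℝ
  | 0, _ => 0
  | n + 1, l => expectation (alg l) fun a =>
      E.binaryStrongRegret m a + expectation (E.duel m a) fun x => algRegretFrom n ((a, x) :: l)

theorem algRegretFrom_nonneg (n : ℕ) (l : DuelHistory K) : 0 ≤ E.algRegretFrom alg m n l := by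
  induction n generalizing l with
  | zero => exact le_rfl
  | succ n ih =>
    exact expectation_nonneg _ fun a =>
      add_nonneg (E.binaryStrongRegret_nonneg m a) (expectation_nonneg _ fun x => ih _)

theorem algRegretFrom_le_succ (n : ℕ) (l : DuelHistory K) :
    E.algRegretFrom alg m n l ≤ E.algRegretFrom alg m (n + 1) l := by
  induction n generalizing l with
  | zero => exact E.algRegretFrom_nonneg alg m 1 l
  | succ n ih =>
    exact expectation_mono (Set.toFinite _) fun a =>
      add_le_add_right (expectation_mono (Set.toFinite _) fun x => ih _) _

theorem finite_support_algLaw (n : ℕ) : (E.algLaw alg m n).support.Finite := by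
  induction n with
  | zero => simp [algLaw]
  | succ n ih =>
    exact finite_support_bind ih fun s => finite_support_bind (Set.toFinite _) fun a =>
      finite_support_map (Set.toFinite _) _

theorem expectation_algLaw_add (n k : ℕ) :
    expectation (E.algLaw alg m n) (fun s => s.2 + E.algRegretFrom alg m k s.1) =
      E.algRegretFrom alg m (n + k) [] := by
  induction n generalizing k with
  | zero => simp [algLaw, expectation_pure]
  | succ n ih =>
    rw [Nat.add_right_comm, Nat.add_assoc, ← ih, algLaw,
      expectation_bind (E.finite_support_algLaw alg m n) fun s =>
        finite_support_bind (Set.toFinite _) fun a => finite_support_map (Set.toFinite _) _]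
    congr 1
    funext s
    rw [expectation_bind (Set.toFinite _) fun a => finite_support_map (Set.toFinite _) _,
      algRegretFrom, ← expectation_const_add (Set.toFinite _)]
    congr 1
    funext a
    rw [expectation_map (Set.toFinite _)]
    simp only [Int.cast_add, expectation_const_add (Set.toFinite _), add_assoc]

theorem algRegret_eq_sum :
    E.algRegret alg = ∑ m, E.algRegretFrom alg m (E.segmentLength m) [] := by
  refine Finset.sum_congr rfl fun m _ => ?_
  rw [← Nat.add_zero (E.segmentLength m), ← expectation_algLaw_add]
  simp only [algRegretFrom, add_zero]

theorem algRegret_nonneg : 0 ≤ E.algRegret alg := by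
  rw [algRegret_eq_sum]
  exact Finset.sum_nonneg fun m _ => E.algRegretFrom_nonneg alg m _ _

end AlgRegretFrom

section MDBRegretFrom

variable (O : Fin (K * (K - 1) / 2) ≃ ArmPair K) (w : ℕ) (b γ : ℝ) (alg : DuelingAlg K)

/-- The expected binary strong regret of MDB over the time steps `t + 1, ..., T` when its state
after the time step `t` is `s`. -/
noncomputable def mdbRegretFrom (t : ℕ) (s : MDBState K) : ℝ :=
  if t < T then
    expectation (E.mdbStep O w b γ alg (t + 1) s) fun q =>
      E.binaryStrongRegret (E.segment (t + 1)) q.2 + mdbRegretFrom (t + 1) q.1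
  else 0
termination_by T - t

theorem finite_support_mdbStep (t : ℕ) (s : MDBState K) :
    (E.mdbStep O w b γ alg t s).support.Finite := by
  rw [mdbStep]
  split_ifs
  · exact finite_support_map (Set.toFinite _) _
  · exact finite_support_bind (Set.toFinite _) fun a => finite_support_map (Set.toFinite _) _

theorem finite_support_mdbLaw (n : ℕ) : (E.mdbLaw O w b γ alg n).support.Finite := by
  induction n with
  | zero => simp [mdbLaw]
  | succ n ih =>
    exact finite_support_bind ih fun s =>
      finite_support_map (E.finite_support_mdbStep O w b γ alg _ _) _

theorem expectation_mdbLaw_add {t : ℕ} (ht : t ≤ T) :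
    expectation (E.mdbLaw O w b γ alg t) (fun s => s.2 + E.mdbRegretFrom O w b γ alg t s.1) =
      E.mdbRegretFrom O w b γ alg 0 (MDBState.fresh K 0) := by
  induction t with
  | zero => simp [mdbLaw, expectation_pure]
  | succ t ih =>
    have hstep := E.finite_support_mdbStep O w b γ alg (t + 1)
    rw [← ih (Nat.le_of_succ_le ht), mdbLaw,
      expectation_bind (E.finite_support_mdbLaw O w b γ alg t)
        fun s => finite_support_map (hstep s.1) _]
    congr 1
    funext s
    rw [expectation_map (hstep s.1), mdbRegretFrom.eq_1 E O w b γ alg t s.1,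
      if_pos (Nat.lt_of_succ_le ht), ← expectation_const_add (hstep s.1)]
    simp only [Int.cast_add, add_assoc]

theorem mdbRegret_eq_mdbRegretFrom :
    E.mdbRegret O w b γ alg = E.mdbRegretFrom O w b γ alg 0 (MDBState.fresh K 0) := by
  rw [← E.expectation_mdbLaw_add O w b γ alg le_rfl, mdbRegret]
  congr 1
  funext s
  rw [mdbRegretFrom, if_neg (lt_irrefl T), add_zero]

theorem mdbRegretFrom_le {t : ℕ} (ht : t ≤ T) (s : MDBState K) :
    E.mdbRegretFrom O w b γ alg t s ≤ T - t := by
  induction ht using Nat.decreasingInduction generalizing s with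
  | self => rw [mdbRegretFrom, if_neg (lt_irrefl T), sub_self]
  | of_succ t ht ih =>
    rw [mdbRegretFrom, if_pos ht, ← expectation_const (E.mdbStep O w b γ alg (t + 1) s) (T - t : ℝ)]
    refine expectation_mono (E.finite_support_mdbStep O w b γ alg _ _) fun q => ?_
    have hrest := ih q.1
    have hstep := E.binaryStrongRegret_le_one (E.segment (t + 1)) q.2
    push_cast at hrest
    linarith

theorem mdbRegretFrom_le_horizon (t : ℕ) (s : MDBState K) :
    E.mdbRegretFrom O w b γ alg t s ≤ T := by
  rcases le_or_gt t T with ht | ht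
  · exact (E.mdbRegretFrom_le O w b γ alg ht s).trans (sub_le_self _ t.cast_nonneg)
  · rw [mdbRegretFrom, if_neg ht.le.not_gt]
    exact T.cast_nonneg

variable {O w b γ alg} {t : ℕ} {s : MDBState K}

open Classical in
theorem mdbRegretFrom_of_detection (ht : t < T) {r : Fin (K * (K - 1) / 2)}
    (hr : (t - s.τ) % mdbCycle K γ = r) :
    E.mdbRegretFrom O w b γ alg t s = E.binaryStrongRegret (E.segment (t + 1)) (O r).1 +
      expectation (E.duel (E.segment (t + 1)) (O r).1) fun z => E.mdbRegretFrom O w b γ alg (t + 1)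
        (if mdbAlarm w b (z :: s.obs (O r)) then MDBState.fresh K (t + 1)
          else { s with obs := Function.update s.obs (O r) (z :: s.obs (O r)) }) := by
  have hsub : t + 1 - s.τ - 1 = t - s.τ := by omega
  have hlt : (t - s.τ) % mdbCycle K γ < K * (K - 1) / 2 := hr ▸ r.2
  have hfin : (⟨(t - s.τ) % mdbCycle K γ, hlt⟩ : Fin (K * (K - 1) / 2)) = r := Fin.ext hr
  rw [mdbRegretFrom, if_pos ht, mdbStep]
  simp only [hsub, dif_pos hlt, hfin]
  rw [expectation_map (Set.toFinite _), ← expectation_const_add (Set.toFinite _)]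

theorem mdbRegretFrom_of_algorithm (ht : t < T)
    (hr : K * (K - 1) / 2 ≤ (t - s.τ) % mdbCycle K γ) :
    E.mdbRegretFrom O w b γ alg t s = expectation (alg s.hist) fun a =>
      E.binaryStrongRegret (E.segment (t + 1)) a + expectation (E.duel (E.segment (t + 1)) a)
        fun z => E.mdbRegretFrom O w b γ alg (t + 1) { s with hist := (a, z) :: s.hist } := by
  have hsub : t + 1 - s.τ - 1 = t - s.τ := by omega
  rw [mdbRegretFrom, if_pos ht, mdbStep, hsub, dif_neg hr.not_gt,
    expectation_bind (Set.toFinite _) fun a => finite_support_map (Set.toFinite _) _]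
  simp only [expectation_map (Set.toFinite _), expectation_const_add (Set.toFinite _)]

end MDBRegretFrom

section Potential

variable {K T N : ℕ} {E : DuelingEnv K T N} {O : Fin (K * (K - 1) / 2) ≃ ArmPair K} {w : ℕ}
  {b γ : ℝ} {alg : DuelingAlg K} {m : Fin (N + 1)} {τ x y : ℕ} {σ ρ : ℝ}
  {f : ArmPair K → List Bool → ℝ} {β : ℕ → DuelHistory K → ℝ}

theorem mdbRegretFrom_le_of_detection {t : ℕ} {s : MDBState K} (ht : t < T)
    {r : Fin (K * (K - 1) / 2)} (hr : (t - s.τ) % mdbCycle K γ = r) {B ρ : ℝ} {G : Bool → ℝ}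
    (restart_le : E.mdbRegretFrom O w b γ alg (t + 1) (MDBState.fresh K (t + 1)) ≤ B + ρ)
    (continue_le : ∀ z, E.mdbRegretFrom O w b γ alg (t + 1)
      { s with obs := Function.update s.obs (O r) (z :: s.obs (O r)) } ≤ B + G z) :
    E.mdbRegretFrom O w b γ alg t s ≤ 1 + (B + expectation (E.duel (E.segment (t + 1)) (O r).1)
      fun z => open Classical in if mdbAlarm w b (z :: s.obs (O r)) then ρ else G z) := by
  rw [mdbRegretFrom_of_detection E ht hr,
    ← expectation_const_add (E.duel (E.segment (t + 1)) (O r).1).support.toFinite B]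
  refine add_le_add (E.binaryStrongRegret_le_one _ _)
    (expectation_mono (Set.toFinite _) fun z => ?_)
  split_ifs
  exacts [restart_le, continue_le z]

theorem mdbRegretFrom_le_of_algorithm {t : ℕ} {s : MDBState K} (ht : t < T)
    (hr : K * (K - 1) / 2 ≤ (t - s.τ) % mdbCycle K γ) {B c : ℝ} {G : DuelHistory K → ℝ}
    (algorithm_le : (expectation (alg s.hist) fun a =>
      E.binaryStrongRegret (E.segment (t + 1)) a +
        expectation (E.duel (E.segment (t + 1)) a) fun z => G ((a, z) :: s.hist)) ≤ B)
    (continue_le : ∀ a z, E.mdbRegretFrom O w b γ alg (t + 1)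
      { s with hist := (a, z) :: s.hist } ≤ c + G ((a, z) :: s.hist)) :
    E.mdbRegretFrom O w b γ alg t s ≤ c + B := by
  refine le_trans ?_ (add_le_add_right algorithm_le c)
  rw [mdbRegretFrom_of_algorithm E ht hr, ← expectation_const_add (Set.toFinite _) c]
  refine expectation_mono (Set.toFinite _) fun a => ?_
  rw [add_left_comm, ← expectation_const_add (E.duel _ a).support.toFinite c]
  exact add_le_add_right (expectation_mono (E.duel _ a).support.toFinite (continue_le a)) _

theorem mdbRegretFrom_le_add_totalMonitoringCost (hσ : 0 ≤ σ) (hρ : 0 ≤ ρ)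
    (hf : ∀ a l, 0 ≤ f a l) (hxy : x ≤ y) (hy : τ + y ≤ T)
    (hseg : ∀ t ∈ Set.Ioc (τ + x) (τ + y), E.segment t = m)
    (restart_le : ∀ i ∈ Set.Ico x y, ∀ l,
      E.mdbRegretFrom O w b γ alg (τ + i + 1) (MDBState.fresh K (τ + i + 1)) ≤ β (i + 1) l + ρ)
    (detection_le : ∀ i ∈ Set.Ico x y, ∀ l, 1 + β (i + 1) l ≤ β i l + σ)
    (algorithm_le : ∀ i ∈ Set.Ico x y, ∀ l, (expectation (alg l) fun a =>
      E.binaryStrongRegret m a + expectation (E.duel m a) fun z => β (i + 1) ((a, z) :: l)) ≤ β i l)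
    (end_le : ∀ s : MDBState K, s.τ = τ →
      E.mdbRegretFrom O w b γ alg (τ + y) s ≤ β y s.hist + ∑ a, f a (s.obs a))
    (s : MDBState K) (hs : s.τ = τ) :
    E.mdbRegretFrom O w b γ alg (τ + x) s ≤ β x s.hist +
      totalMonitoringCost O (mdbCycle K γ) w b σ ρ (fun a => E.duel m a.1) f x y s.obs := by
  set total := totalMonitoringCost O (mdbCycle K γ) w b σ ρ (fun a => E.duel m a.1) f
  refine Nat.decreasingInduction' (P := fun i => ∀ s : MDBState K, s.τ = τ →
      E.mdbRegretFrom O w b γ alg (τ + i) s ≤ β i s.hist + total i y s.obs)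
    (fun i hiy hxi ih s hs => ?_) hxy
    (fun s hs => (end_le s hs).trans_eq (by simp only [total, totalMonitoringCost_self])) s hs
  have hm : E.segment (τ + i + 1) = m := hseg _ ⟨by omega, by omega⟩
  have hi : τ + i - s.τ = i := by omega
  have hiT : τ + i < T := by omega
  rcases lt_or_ge (i % mdbCycle K γ) (K * (K - 1) / 2) with hr | hr
  · obtain ⟨r, hr⟩ : ∃ r : Fin (K * (K - 1) / 2), i % mdbCycle K γ = r := ⟨⟨_, hr⟩, rfl⟩
    have hcost := add_expectation_totalMonitoringCost_le (O := O) (w := w) (b := b)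
      (μ := fun a => E.duel m a.1) (obs := s.obs) hσ hρ hf hiy hr
    have hstep := mdbRegretFrom_le_of_detection hiT (hi.symm ▸ hr)
      (restart_le i ⟨hxi, hiy⟩ s.hist) fun z => ih { s with obs := _ } hs
    rw [hm] at hstep
    linarith [detection_le i ⟨hxi, hiy⟩ s.hist]
  · rw [show total i y s.obs = total (i + 1) y s.obs from totalMonitoringCost_of_le_mod hiy hr,
      add_comm (β i s.hist)]
    refine mdbRegretFrom_le_of_algorithm (G := β (i + 1)) hiT (hi.symm ▸ hr)
      (hm.symm ▸ algorithm_le i ⟨hxi, hiy⟩ s.hist) fun a z => ?_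
    exact (ih { s with hist := (a, z) :: s.hist } hs).trans_eq (add_comm _ _)

end Potential

variable {K T N : ℕ} (E : DuelingEnv K T N)

section SegmentEnd

theorem segment_mono : Monotone E.segment := fun _ _ hst =>
  Fin.mk_le_mk.2 (Finset.card_le_card (Finset.monotone_filter_right _ fun _ _ hk => hk.trans hst))

/-- The last time step before segment `j`, and the horizon for `j = N + 1`. -/
def segmentEnd (j : ℕ) : ℕ := Nat.findGreatest (fun t => (E.segment t : ℕ) < j) T

theorem segmentEnd_le (j : ℕ) : E.segmentEnd j ≤ T := Nat.findGreatest_le T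

theorem le_segmentEnd_iff {t : ℕ} (ht : 1 ≤ t) (htT : t ≤ T) (j : ℕ) :
    t ≤ E.segmentEnd j ↔ (E.segment t : ℕ) < j := by
  refine ⟨fun h => ?_, fun h => Nat.le_findGreatest htT h⟩
  exact (Fin.le_def.1 (E.segment_mono h)).trans_lt
    (Nat.findGreatest_of_ne_zero (m := E.segmentEnd j) rfl (by omega))

theorem segmentEnd_zero : E.segmentEnd 0 = 0 :=
  Nat.findGreatest_eq_zero_iff.2 fun _ _ _ => Nat.not_lt_zero _

theorem segmentEnd_last : E.segmentEnd (N + 1) = T :=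
  Nat.findGreatest_eq (E.segment T).2

theorem segment_eq_iff {t : ℕ} (ht : 1 ≤ t) (htT : t ≤ T) (m : Fin (N + 1)) :
    E.segment t = m ↔ t ∈ Set.Ioc (E.segmentEnd m) (E.segmentEnd (m + 1)) := by
  rw [Set.mem_Ioc, ← not_le, E.le_segmentEnd_iff ht htT, E.le_segmentEnd_iff ht htT, Fin.ext_iff]
  omega

theorem segment_eq_of_mem_Ioc {m : Fin (N + 1)} {t : ℕ}
    (ht : t ∈ Set.Ioc (E.segmentEnd m) (E.segmentEnd (m + 1))) : E.segment t = m :=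
  (E.segment_eq_iff (Nat.one_le_of_lt ht.1) (ht.2.trans (E.segmentEnd_le _)) m).2 ht

theorem segmentEnd_succ (m : Fin (N + 1)) :
    E.segmentEnd (m + 1) = E.segmentEnd m + E.segmentLength m := by
  have hmono : E.segmentEnd m ≤ E.segmentEnd (m + 1) :=
    Nat.findGreatest_mono_left (fun _ => Nat.lt_succ_of_lt) T
  have hfilter : (Finset.Icc 1 T).filter (fun t => E.segment t = m) =
      Finset.Ioc (E.segmentEnd m) (E.segmentEnd (m + 1)) := by
    ext t
    have hT := E.segmentEnd_le (m + 1)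
    rw [Finset.mem_filter, Finset.mem_Icc, Finset.mem_Ioc]
    refine ⟨fun h => (E.segment_eq_iff h.1.1 h.1.2 m).1 h.2, fun h => ?_⟩
    exact ⟨by omega, E.segment_eq_of_mem_Ioc h⟩
  rw [segmentLength, hfilter, Nat.card_Ioc, Nat.add_sub_cancel' hmono]

theorem sum_segmentLength : ∑ m, E.segmentLength m = T := by
  have hfibers := Finset.card_eq_sum_card_fiberwise (f := E.segment) (s := Finset.Icc 1 T)
    (t := Finset.univ) fun _ _ => Finset.mem_coe.2 (Finset.mem_univ _)
  rw [Nat.card_Icc, Nat.add_sub_cancel] at hfibers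
  exact hfibers.symm

end SegmentEnd

section Segment

variable {K T N : ℕ} {E : DuelingEnv K T N} {O : Fin (K * (K - 1) / 2) ≃ ArmPair K} {h : ℕ}
  {c b γ H : ℝ} {w : ℕ} {alg : DuelingAlg K} {m : Fin (N + 1)} {t n : ℕ}

theorem mdbRegretFrom_fresh_le {f : ArmPair K → List Bool → ℝ} (hc : 0 ≤ c) (hH : 0 ≤ H)
    (hf : ∀ a l, 0 ≤ f a l) (hcyc : K * (K - 1) / 2 ≤ mdbCycle K γ) (hn : t + n ≤ T)
    (hseg : ∀ u ∈ Set.Ioc t (t + n), E.segment u = m)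
    (end_le : ∀ s : MDBState K, s.τ = t → E.mdbRegretFrom O (2 * h) (h * c) γ alg (t + n) s ≤
      H + ∑ a, f a (s.obs a)) :
    E.mdbRegretFrom O (2 * h) (h * c) γ alg t (MDBState.fresh K t) ≤
      E.algRegretFrom alg m n [] + H +
        ∑ a, expectationAfter (E.duel m a.1) (visits (mdbCycle K γ) (O.symm a) 0 n) (f a) [] +
        (K * (K - 1) / 2 : ℕ) * (n / mdbCycle K γ + 1 : ℕ) *
          (1 + T * (2 * Real.exp (-(h * c ^ 2)))) := by
  set β : ℕ → DuelHistory K → ℝ := fun i l => E.algRegretFrom alg m (n - i) l + H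
  have hβ : ∀ i l, 0 ≤ β i l := fun i l => add_nonneg (E.algRegretFrom_nonneg alg m _ l) hH
  have hsub : ∀ {i}, i < n → n - i = n - (i + 1) + 1 := by omega
  have hmain := E.mdbRegretFrom_le_add_totalMonitoringCost (O := O) (w := 2 * h) (b := h * c)
    (γ := γ) (alg := alg) (σ := 1) (ρ := T) (β := β) (x := 0) zero_le_one T.cast_nonneg hf
    n.zero_le hn hseg
    (fun i _ l => (E.mdbRegretFrom_le_horizon O _ _ γ alg _ _).trans
      (le_add_of_nonneg_left (hβ _ l)))
    (fun i hi l => by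
      simp only [β, hsub hi.2]
      linarith [E.algRegretFrom_le_succ alg m (n - (i + 1)) l])
    (fun i hi l => by
      simp only [β, hsub hi.2, algRegretFrom, ← add_assoc,
        expectation_add (E.duel m _).support.toFinite,
        expectation_add (alg l).support.toFinite, expectation_const, le_refl])
    (fun s hs => (end_le s hs).trans (add_le_add_left
      (le_add_of_nonneg_left (E.algRegretFrom_nonneg alg m _ _)) _))
    (MDBState.fresh K t) rfl
  refine hmain.trans ?_
  rw [add_assoc (_ + H)]
  exact add_le_add_right
    (totalMonitoringCost_nil_le zero_le_one T.cast_nonneg hf hcyc n h hc) _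

theorem mdbRegretFrom_stale_le (hH : 0 ≤ H) (hcyc : K * (K - 1) / 2 ≤ mdbCycle K γ)
    (hT : t + h * mdbCycle K γ ≤ T)
    (hseg : ∀ u ∈ Set.Ioc t (t + h * mdbCycle K γ), E.segment u = m)
    (restart_le : ∀ u ∈ Set.Icc t (t + h * mdbCycle K γ),
      E.mdbRegretFrom O w b γ alg u (MDBState.fresh K u) ≤ H)
    (p : ArmPair K) (s : MDBState K) (hs : s.τ ≤ t) :
    E.mdbRegretFrom O w b γ alg t s ≤
      h * mdbCycle K γ + H + monitoringCost (E.duel m p.1) w b 0 0 (fun _ => T) h (s.obs p) := by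
  classical
  set y := t - s.τ + h * mdbCycle K γ with hy
  set β : ℕ → DuelHistory K → ℝ := fun i _ => y - i + H
  have hts : s.τ + (t - s.τ) = t := Nat.add_sub_cancel' hs
  have hty : s.τ + y = t + h * mdbCycle K γ := by omega
  have hmain := E.mdbRegretFrom_le_add_totalMonitoringCost (O := O) (w := w) (b := b) (γ := γ)
    (alg := alg) (m := m) (σ := 0) (ρ := 0) (β := β) (x := t - s.τ) (y := y) (τ := s.τ)
    (f := fun a _ => if a = p then T else 0) le_rfl le_rfl
    (fun a _ => by positivity) (by omega) (by omega) (by rwa [hts, hty])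
    (fun i hi l => by
      have hiy : ((i + 1 : ℕ) : ℝ) ≤ y := Nat.cast_le.2 hi.2
      linarith [restart_le (s.τ + i + 1) ⟨by have := hi.1; omega, by have := hi.2; omega⟩])
    (fun i _ l => by simp only [β, Nat.cast_add_one]; linarith)
    (fun i _ l => by
      simp only [β, expectation_const]
      refine (expectation_mono (alg l).support.toFinite fun a =>
        add_le_add_left (E.binaryStrongRegret_le_one m a) _).trans_eq ?_
      rw [expectation_const, Nat.cast_add_one]
      ring)
    (fun s' _ => by
      simpa [β] using (E.mdbRegretFrom_le_horizon O w b γ alg _ s').trans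
        (le_add_of_nonneg_left hH))
    s rfl
  rw [hts] at hmain
  refine hmain.trans (add_le_add (le_of_eq ?_) (le_of_eq ?_))
  · simp [β, hy]
  · rw [totalMonitoringCost, Finset.sum_eq_single p
      (fun a _ ha => by simp only [if_neg ha, monitoringCost_zero])
      fun hp => absurd (Finset.mem_univ p) hp, hy, visits_add_mul ((O.symm p).2.trans_le hcyc)]
    simp only [if_true]

end Segment

section Segments

variable {K T N : ℕ} {E : DuelingEnv K T N} {O : Fin (K * (K - 1) / 2) ≃ ArmPair K} {h : ℕ}
  {c γ H : ℝ} {alg : DuelingAlg K} {m : Fin (N + 1)}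

/-- The contribution of segment `m` to the bound on the regret of MDB: the regret of the black-box
algorithm, the detection steps with their false alarms, a missed detection of the next changepoint,
and the delay until the detection of the changepoint at which the segment starts. The window has
length `2 * h`, and `q` bounds the error probability of a single test. -/
noncomputable def segmentCost (E : DuelingEnv K T N) (h : ℕ) (γ q : ℝ) (alg : DuelingAlg K)
    (m : Fin (N + 1)) : ℝ :=
  E.algRegretFrom alg m (E.segmentLength m) [] +
    (K * (K - 1) / 2 : ℕ) * (E.segmentLength m / mdbCycle K γ + 1) * (1 + T * (2 * q)) +
    T * q + h * mdbCycle K γ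

theorem mul_mdbCycle_le_segmentCost {q : ℝ} (hq : 0 ≤ q) :
    h * mdbCycle K γ ≤ E.segmentCost h γ q alg m := by
  have halg := E.algRegretFrom_nonneg alg m (E.segmentLength m) []
  exact le_add_of_nonneg_left (by positivity)

theorem mdbRegretFrom_fresh_add_le_segmentCost_add {f : ArmPair K → List Bool → ℝ} (hc : 0 ≤ c)
    (hH : 0 ≤ H) (hf : ∀ a l, 0 ≤ f a l) (hcyc : K * (K - 1) / 2 ≤ mdbCycle K γ)
    (hlen : 2 * h * mdbCycle K γ ≤ E.segmentLength m)
    (missed_le : ∀ v : ArmPair K → ℕ, (∀ a, h ≤ v a) →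
      ∑ a, expectationAfter (E.duel m a.1) (v a) (f a) [] ≤ T * Real.exp (-(h * c ^ 2)))
    (end_le : ∀ s : MDBState K, s.τ ≤ E.segmentEnd (m + 1) →
      E.mdbRegretFrom O (2 * h) (h * c) γ alg (E.segmentEnd (m + 1)) s ≤
        H + ∑ a, f a (s.obs a))
    {t : ℕ} (ht : t ∈ Set.Icc (E.segmentEnd m) (E.segmentEnd m + h * mdbCycle K γ)) :
    E.mdbRegretFrom O (2 * h) (h * c) γ alg t (MDBState.fresh K t) + h * mdbCycle K γ ≤
      E.segmentCost h γ (Real.exp (-(h * c ^ 2))) alg m + H := by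
  obtain ⟨hmt, hth⟩ := ht
  have hsucc := E.segmentEnd_succ m
  rw [mul_assoc, two_mul] at hlen
  obtain ⟨n, hn⟩ := Nat.exists_eq_add_of_le (show t ≤ E.segmentEnd (m + 1) by omega)
  have hn_le : n ≤ E.segmentLength m := by omega
  have hle_n : 0 + h * mdbCycle K γ ≤ n := by omega
  have hvisits (a : ArmPair K) : h ≤ visits (mdbCycle K γ) (O.symm a) 0 n :=
    (visits_add_mul ((O.symm a).2.trans_le hcyc) 0 h).ge.trans (visits_mono hle_n)
  have halg : E.algRegretFrom alg m n [] ≤ E.algRegretFrom alg m (E.segmentLength m) [] :=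
    monotone_nat_of_le_succ (fun k => E.algRegretFrom_le_succ alg m k []) hn_le
  have hcycles : ((n / mdbCycle K γ + 1 : ℕ) : ℝ) ≤ E.segmentLength m / mdbCycle K γ + 1 := by
    rw [Nat.cast_add_one]
    refine add_le_add_left (Nat.cast_div_le.trans ?_) 1
    gcongr
  have hdetection : (K * (K - 1) / 2 : ℕ) * ((n / mdbCycle K γ + 1 : ℕ) : ℝ) *
      (1 + T * (2 * Real.exp (-(h * c ^ 2)))) ≤ (K * (K - 1) / 2 : ℕ) *
        (E.segmentLength m / mdbCycle K γ + 1) * (1 + T * (2 * Real.exp (-(h * c ^ 2)))) := by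
    gcongr
  have hfresh := mdbRegretFrom_fresh_le (O := O) (alg := alg) hc hH hf hcyc
    (hn ▸ E.segmentEnd_le (m + 1))
    (fun u hu => E.segment_eq_of_mem_Ioc ⟨hmt.trans_lt hu.1, hn ▸ hu.2⟩)
    (fun s hs => by rw [← hn]; exact end_le s (by omega))
  rw [segmentCost]
  linarith [missed_le _ hvisits]

theorem mdbRegretFrom_segmentEnd_le {w : ℕ} {b : ℝ} (hcyc : K * (K - 1) / 2 ≤ mdbCycle K γ)
    (hlen : 2 * h * mdbCycle K γ ≤ E.segmentLength m) (hH : h * mdbCycle K γ ≤ H)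
    (restart_le : ∀ u ∈ Set.Icc (E.segmentEnd m) (E.segmentEnd m + h * mdbCycle K γ),
      E.mdbRegretFrom O w b γ alg u (MDBState.fresh K u) + h * mdbCycle K γ ≤ H)
    (p : ArmPair K) (s : MDBState K) (hs : s.τ ≤ E.segmentEnd m) :
    E.mdbRegretFrom O w b γ alg (E.segmentEnd m) s ≤
      H + monitoringCost (E.duel m p.1) w b 0 0 (fun _ => T) h (s.obs p) := by
  have hend : E.segmentEnd m + h * mdbCycle K γ ≤ E.segmentEnd (m + 1) := by
    rw [mul_assoc, two_mul] at hlen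
    rw [E.segmentEnd_succ]
    omega
  have hstale := mdbRegretFrom_stale_le (sub_nonneg.2 hH) hcyc (hend.trans (E.segmentEnd_le _))
    (fun u hu => E.segment_eq_of_mem_Ioc ⟨hu.1, hu.2.trans hend⟩)
    (fun u hu => le_sub_iff_add_le.2 (restart_le u hu)) p s hs
  rwa [add_sub_cancel] at hstale

theorem mdbRegretFrom_fresh_add_le_sum (hh : 0 < h) (hc : 0 ≤ c)
    (hcyc : K * (K - 1) / 2 ≤ mdbCycle K γ)
    (hlen : ∀ m, 2 * h * mdbCycle K γ ≤ E.segmentLength m)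
    (hchange : ∀ k : Fin N, ∃ a : ArmPair K,
      2 * c ≤ |E.P k.castSucc a.1.1 a.1.2 - E.P k.succ a.1.1 a.1.2|)
    (m : Fin (N + 1)) {t : ℕ}
    (ht : t ∈ Set.Icc (E.segmentEnd m) (E.segmentEnd m + h * mdbCycle K γ)) :
    E.mdbRegretFrom O (2 * h) (h * c) γ alg t (MDBState.fresh K t) + h * mdbCycle K γ ≤
      ∑ i ∈ Finset.Ici m, E.segmentCost h γ (Real.exp (-(h * c ^ 2))) alg i := by
  induction m using Fin.reverseInduction generalizing t with
  | last =>
    refine (mdbRegretFrom_fresh_add_le_segmentCost_add (H := 0) (f := fun _ _ => 0) hc le_rfl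
      (fun _ _ => le_rfl) hcyc (hlen _) (fun v _ => ?_) (fun s _ => ?_) ht).trans_eq ?_
    · simp only [expectationAfter_const, Finset.sum_const_zero]
      positivity
    · simp [mdbRegretFrom, E.segmentEnd_last]
    · rw [← Fin.top_eq_last, Finset.Ici_top, Finset.sum_singleton, add_zero]
  | cast k ih =>
    obtain ⟨p, hp⟩ := hchange k
    set missed : List Bool → ℝ :=
      monitoringCost (E.duel k.succ p.1) (2 * h) (h * c) 0 0 (fun _ => T) h
    set rest := ∑ i ∈ Finset.Ici k.succ, E.segmentCost h γ (Real.exp (-(h * c ^ 2))) alg i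
    have hcost (i : Fin (N + 1)) := mul_mdbCycle_le_segmentCost (E := E) (h := h) (γ := γ)
      (alg := alg) (m := i) (Real.exp_nonneg (-(h * c ^ 2)))
    have hrest : h * mdbCycle K γ ≤ rest := (hcost k.succ).trans (Finset.single_le_sum
      (fun i _ => le_trans (by positivity) (hcost i)) (Finset.mem_Ici.2 le_rfl))
    rw [← toReal_duel_true, ← toReal_duel_true] at hp
    refine (mdbRegretFrom_fresh_add_le_segmentCost_add (H := rest)
      (f := fun a l => if a = p then missed l else 0) hc (le_trans (by positivity) hrest)
      (fun a l => ?_) hcyc (hlen _) (fun v hv => ?_) (fun s hs => ?_) ht).trans_eq ?_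
    · split_ifs
      exacts [monitoringCost_nonneg le_rfl le_rfl (fun _ => T.cast_nonneg) h l, le_rfl]
    · rw [Finset.sum_eq_single p (fun a _ ha => by simp only [if_neg ha, expectationAfter_const])
        fun hp => absurd (Finset.mem_univ p) hp]
      simpa only [if_true] using
        expectationAfter_monitoringCost_le hh (hv p) hc T.cast_nonneg hp
    · rw [Fintype.sum_ite_eq' p fun a => missed (s.obs a)]
      exact mdbRegretFrom_segmentEnd_le hcyc (hlen _) hrest (fun u hu => ih hu) p s hs
    · have hIoi : Finset.Ioi k.castSucc = Finset.Ici k.succ :=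
        Finset.ext fun i => by
          simp only [Finset.mem_Ioi, Finset.mem_Ici, Fin.castSucc_lt_iff_succ_le]
      rw [← Finset.Ioi_insert, Finset.sum_insert Finset.notMem_Ioi_self, hIoi]

theorem mdbRegret_le (hh : 0 < h) (hc : 0 ≤ c) (hcyc : K * (K - 1) / 2 ≤ mdbCycle K γ)
    (hlen : ∀ m, 2 * h * mdbCycle K γ ≤ E.segmentLength m)
    (hchange : ∀ k : Fin N, ∃ a : ArmPair K,
      2 * c ≤ |E.P k.castSucc a.1.1 a.1.2 - E.P k.succ a.1.1 a.1.2|) :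
    E.mdbRegret O (2 * h) (h * c) γ alg ≤
      (K * (K - 1) / 2 : ℕ) * (T / mdbCycle K γ + (N + 1)) *
          (1 + T * (2 * Real.exp (-(h * c ^ 2)))) +
        (N + 1) * (T * Real.exp (-(h * c ^ 2)) + h * mdbCycle K γ) + E.algRegret alg := by
  have hmain := mdbRegretFrom_fresh_add_le_sum (O := O) (alg := alg) hh hc hcyc hlen hchange 0
    (t := 0) ⟨(E.segmentEnd_zero).le, Nat.zero_le _⟩
  have hT : ∑ m, (E.segmentLength m : ℝ) = T := by exact_mod_cast E.sum_segmentLength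
  rw [mdbRegret_eq_mdbRegretFrom]
  refine (le_add_of_nonneg_right (by positivity)).trans (hmain.trans_eq ?_)
  rw [← bot_eq_zero, Finset.Ici_bot]
  simp only [segmentCost, algRegret_eq_sum, Finset.sum_add_distrib, ← Finset.mul_sum,
    ← Finset.sum_mul, ← Finset.sum_div, hT, Finset.sum_const, Finset.card_univ, Fintype.card_fin,
    nsmul_eq_mul, Nat.cast_add_one, mul_one]
  ring

end Segments

section MinimalChange

variable {K T N : ℕ} {E : DuelingEnv K T N}

theorem pos_of_minimalChange_pos (hδ : 0 < E.minimalChange) : 0 < N := by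
  rcases N.eq_zero_or_pos with rfl | hN
  · exact absurd hδ (by simp [minimalChange])
  · exact hN

theorem exists_armPair_minimalChange_le (hδ : 0 < E.minimalChange) (k : Fin N) :
    ∃ a : ArmPair K,
      E.minimalChange ≤ |E.P k.castSucc a.1.1 a.1.2 - E.P k.succ a.1.1 a.1.2| := by
  have hne : Nonempty (Fin K × Fin K) := ⟨(E.cw 0, E.cw 0)⟩
  obtain ⟨⟨i, j⟩, hij⟩ := exists_eq_ciSup_of_finite
    (f := fun a : Fin K × Fin K => |E.P k.succ a.1 a.2 - E.P k.castSucc a.1 a.2|)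
  have hle : E.minimalChange ≤ |E.P k.succ i j - E.P k.castSucc i j| :=
    (ciInf_le (Set.finite_range E.segmentalChange).bddBelow k).trans_eq hij.symm
  have hsucc := E.P_add k.succ i j
  have hcast := E.P_add k.castSucc i j
  rcases lt_trichotomy i j with hlt | rfl | hlt
  · exact ⟨⟨(i, j), hlt⟩, by rwa [abs_sub_comm]⟩
  · rw [show E.P k.succ i i - E.P k.castSucc i i = 0 by linarith, abs_zero] at hle
    exact absurd hδ hle.not_gt
  · refine ⟨⟨(j, i), hlt⟩, hle.trans_eq (congrArg _ ?_)⟩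
    linarith

theorem two_le_of_minimalChange_pos (hδ : 0 < E.minimalChange) : 2 ≤ K := by
  obtain ⟨a, -⟩ := exists_armPair_minimalChange_le hδ ⟨0, pos_of_minimalChange_pos hδ⟩
  exact (Nat.succ_le_of_lt (Nat.zero_lt_of_lt a.2)).trans_lt a.1.2.2

theorem minimalChange_le_one (hδ : 0 < E.minimalChange) : E.minimalChange ≤ 1 := by
  obtain ⟨a, ha⟩ := exists_armPair_minimalChange_le hδ ⟨0, pos_of_minimalChange_pos hδ⟩
  exact ha.trans (abs_sub_le_of_nonneg_of_le (E.P_mem _ _ _).1 (E.P_mem _ _ _).2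
    (E.P_mem _ _ _).1 (E.P_mem _ _ _).2)

theorem cast_horizon_pos (hδ : 0 < E.minimalChange) : (0 : ℝ) < T := by
  have hN := pos_of_minimalChange_pos hδ
  exact_mod_cast (zero_lt_one.trans (E.one_lt_changepoint ⟨0, hN⟩)).trans_le (E.changepoint_le _)

theorem mul_le_horizon {L : ℕ} (hL : ∀ m, L ≤ E.segmentLength m) : (N + 1) * L ≤ T := by
  have hsum := Finset.card_nsmul_le_sum Finset.univ E.segmentLength L fun m _ => hL m
  rwa [E.sum_segmentLength, Finset.card_univ, Fintype.card_fin, smul_eq_mul] at hsum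

end MinimalChange

end DuelingEnv

section Parameters

/-- The quotient `√(2T) (2T + 1) / (√M K)`, of which the parameter `C` is the logarithm. -/
noncomputable def horizonQuotient (T M K : ℝ) : ℝ := √(2 * T) * (2 * T + 1) / (√M * K)

section HorizonQuotient

variable {T M K : ℝ}

theorem exp_one_le_horizonQuotient (hM : 1 ≤ M) (hK : 1 ≤ K) (hT : 2 * M * K ≤ T) :
    Real.exp 1 ≤ horizonQuotient T M K := by
  have hMT : M ≤ 2 * T := by nlinarith
  have hKT : 2 * K ≤ T := by nlinarith
  rw [horizonQuotient, le_div_iff₀ (mul_pos (Real.sqrt_pos.2 (by linarith)) (by linarith))]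
  calc Real.exp 1 * (√M * K) ≤ 4 * (√M * K) := by
        gcongr
        linarith [Real.exp_one_lt_d9]
    _ = √M * (4 * K) := by ring
    _ ≤ √(2 * T) * (2 * T + 1) := by
        gcongr
        linarith

theorem horizonQuotient_le_pow (hM : 1 ≤ M) (hK : 1 ≤ K) (hT : 4 ≤ T) :
    horizonQuotient T M K ≤ T ^ 3 := by
  have hsqrt : √(2 * T) ≤ T := Real.sqrt_le_iff.2 ⟨by linarith, by nlinarith⟩
  calc horizonQuotient T M K ≤ √(2 * T) * (2 * T + 1) :=
        div_le_self (by positivity) (one_le_mul_of_one_le_of_one_le (Real.one_le_sqrt.2 hM) hK)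
    _ ≤ T * T ^ 2 := by gcongr; nlinarith
    _ = T ^ 3 := by ring

theorem log_horizonQuotient_mem_Icc (hM : 1 ≤ M) (hK : 2 ≤ K) (hT : 2 * M * K ≤ T) :
    Real.log (horizonQuotient T M K) ∈ Set.Icc 1 (3 * Real.log T) := by
  have hK1 : 1 ≤ K := one_le_two.trans hK
  have hexp := exp_one_le_horizonQuotient hM hK1 hT
  have hpos := (Real.exp_pos 1).trans_le hexp
  refine ⟨(Real.le_log_iff_exp_le hpos).2 hexp, ?_⟩
  have hpow := Real.log_le_log hpos (horizonQuotient_le_pow hM hK1 (by nlinarith : 4 ≤ T))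
  rwa [Real.log_pow] at hpow

theorem sq_mul_inv_horizonQuotient_le (hM : 0 < M) (hK : 0 < K) (hT : 0 < T) :
    T ^ 2 * (horizonQuotient T M K)⁻¹ ≤ K * √(M * T) / 2 := by
  have hsqrt : √T ≤ √(2 * T) := Real.sqrt_le_sqrt (by linarith)
  have hsq := Real.mul_self_sqrt hT.le
  rw [horizonQuotient, inv_div, Real.sqrt_mul hM.le, ← mul_div_assoc, div_le_iff₀ (by positivity)]
  calc T ^ 2 * (√M * K) = K * (√M * √T) / 2 * (√T * (2 * T)) := by
        linear_combination (-(T * √M * K)) * hsq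
    _ ≤ K * (√M * √T) / 2 * (√(2 * T) * (2 * T + 1)) := by
        gcongr
        linarith

theorem sq_mul_exp_neg_le {C δ : ℝ} (hM : 0 < M) (hK : 0 < K) (hT : 0 < T)
    (hC : C = Real.log (horizonQuotient T M K)) (hC1 : 1 ≤ C) (hδ : 0 < δ) (hδ1 : δ ≤ 1) :
    T ^ 2 * Real.exp (-C) ≤ 1 / 2 * (K * √(M * T * C) / δ) := by
  have hquot : 0 < horizonQuotient T M K := by unfold horizonQuotient; positivity
  calc T ^ 2 * Real.exp (-C) = T ^ 2 * (horizonQuotient T M K)⁻¹ := by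
        rw [hC, Real.exp_neg, Real.exp_log hquot]
    _ ≤ K * √(M * T) / 2 := sq_mul_inv_horizonQuotient_le hM hK hT
    _ = 1 / 2 * (K * √(M * T * 1) / 1) := by rw [mul_one]; ring
    _ ≤ 1 / 2 * (K * √(M * T * C) / δ) := by gcongr

end HorizonQuotient

theorem isLeast_even_le {x : ℝ} (hx : 0 ≤ x) {w : ℕ}
    (hw : IsLeast {v : ℕ | Even v ∧ x ≤ v} w) : (w : ℝ) ≤ x + 2 := by
  have hceil : w ≤ 2 * ⌈x / 2⌉₊ :=
    hw.2 ⟨even_two_mul _, by push_cast; linarith [Nat.le_ceil (x / 2)]⟩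
  have hlt := Nat.ceil_lt_add_one (div_nonneg hx zero_le_two)
  have hcast : (w : ℝ) ≤ 2 * ⌈x / 2⌉₊ := by exact_mod_cast hceil
  linarith

theorem mul_sqrt_div_le {T M w C δ : ℝ} (hT : 0 < T) (hM : 0 ≤ M) (hw : 0 ≤ w) (hC : 0 ≤ C)
    (hδ : 0 < δ) (hwC : w ≤ 10 * C / δ ^ 2) :
    T * √(M * w / (8 * T)) ≤ 5 / 4 * (√(M * T * C) / δ) := by
  have hsq : √(M * w / (8 * T)) ^ 2 = M * w / (8 * T) := Real.sq_sqrt (by positivity)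
  have hwδ : w * δ ^ 2 ≤ 10 * C := (le_div_iff₀ (by positivity)).1 hwC
  have hsqrt : 4 / 5 * (T * √(M * w / (8 * T)) * δ) ≤ √(M * T * C) := by
    refine Real.le_sqrt_of_sq_le ?_
    calc _ = 16 / 25 * T ^ 2 * √(M * w / (8 * T)) ^ 2 * δ ^ 2 := by ring
      _ = 2 / 25 * (M * T) * (w * δ ^ 2) := by rw [hsq]; field_simp; ring
      _ ≤ 2 / 25 * (M * T) * (10 * C) := by gcongr
      _ ≤ M * T * C := by nlinarith [show 0 ≤ M * T * C by positivity]
  rw [← mul_div_assoc, le_div_iff₀ hδ]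
  linarith

theorem mul_sqrt_log_le {T ε C y k δ s : ℝ} (hT : 0 < T) (hε : 0 < ε) (hk : 0 ≤ k) (hs : 0 ≤ s)
    (hδ : 0 < δ) (hC : C ≤ 3 * Real.log T) (hy : T ^ ε ≤ y) :
    k * √(s * C) / δ ≤ √(3 / ε) * (k * √(s * Real.log y) / δ) := by
  have hlog : ε * Real.log T ≤ Real.log y := by
    rw [← Real.log_rpow hT]
    exact Real.log_le_log (Real.rpow_pos_of_pos hT ε) hy
  have hCy : s * C ≤ 3 / ε * (s * Real.log y) := by
    calc s * C ≤ s * (3 * Real.log T) := by gcongr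
      _ = 3 / ε * (s * (ε * Real.log T)) := by field_simp
      _ ≤ 3 / ε * (s * Real.log y) := by gcongr
  calc k * √(s * C) / δ ≤ k * √(3 / ε * (s * Real.log y)) / δ := by gcongr
    _ = √(3 / ε) * (k * √(s * Real.log y) / δ) := by
        rw [Real.sqrt_mul (by positivity)]
        ring

end Parameters

section Cycle

variable {K : ℕ} {γ : ℝ}

theorem cast_mul_pred_div_two (K : ℕ) : ((K * (K - 1) / 2 : ℕ) : ℝ) = K * (K - 1) / 2 := by
  rw [← Nat.choose_two_right, Nat.cast_choose_two]

theorem le_mdbCycle (hK : 2 ≤ K) (hγ : 0 < γ) (hγK : γ ≤ ((K : ℝ) - 1) / 2) :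
    K ≤ mdbCycle K γ := by
  refine Nat.le_floor ?_
  rw [le_div_iff₀ (by positivity)]
  gcongr
  linarith

theorem half_le_mdbCycle (hγ : 0 < γ) (hγ1 : γ ≤ 1) : K * (K - 1) / 2 ≤ mdbCycle K γ := by
  refine Nat.le_floor ?_
  have hnonneg : (0 : ℝ) ≤ K * (K - 1) / 2 := cast_mul_pred_div_two K ▸ Nat.cast_nonneg _
  rw [cast_mul_pred_div_two, ← div_div]
  exact le_div_self hnonneg hγ hγ1

theorem mdbCycle_mul_le (hK : 1 ≤ K) (hγ : 0 < γ) :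
    mdbCycle K γ * (2 * γ) ≤ (K : ℝ) * (K - 1) := by
  have hK1 : (1 : ℝ) ≤ K := by exact_mod_cast hK
  refine (le_div_iff₀ (by positivity)).1 (Nat.floor_le ?_)
  exact div_nonneg (mul_nonneg (by positivity) (by linarith)) (by positivity)

theorem le_mdbCycle_mul (hγ : 0 < γ) (hcyc : 1 ≤ mdbCycle K γ) :
    (K : ℝ) * (K - 1) ≤ mdbCycle K γ * (4 * γ) := by
  have hfloor : (K : ℝ) * (K - 1) / (2 * γ) < mdbCycle K γ + 1 := Nat.lt_floor_add_one _
  have hcyc1 : (1 : ℝ) ≤ mdbCycle K γ := by exact_mod_cast hcyc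
  rw [div_lt_iff₀ (by positivity)] at hfloor
  nlinarith

end Cycle

section Threshold

variable {h C : ℝ}

theorem mul_sqrt_sq_eq (hh : 0 < h) (hC : 0 ≤ C) : h * √(2 * C / (2 * h)) ^ 2 = C := by
  rw [Real.sq_sqrt (by positivity)]
  field_simp

theorem sqrt_mul_div_two_eq (hh : 0 < h) : √(2 * h * C / 2) = h * √(2 * C / (2 * h)) := by
  rw [show 2 * h * C / 2 = h ^ 2 * (2 * C / (2 * h)) by field_simp,
    Real.sqrt_mul (by positivity), Real.sqrt_sq hh.le]

theorem two_mul_sqrt_le {δ : ℝ} (hh : 0 < h) (hδ : 0 < δ) (hw : 8 * C / δ ^ 2 ≤ 2 * h) :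
    2 * √(2 * C / (2 * h)) ≤ δ := by
  rw [← le_div_iff₀' two_pos, Real.sqrt_le_left (by positivity), div_le_iff₀ (by positivity)]
  rw [div_le_iff₀ (by positivity)] at hw
  linarith

end Threshold

theorem exploration_add_delay_le {T M K Y κ n h q : ℝ} (hT : 0 < T) (hM : 0 ≤ M) (hY : 0 ≤ Y)
    (hκ : 0 ≤ κ) (hn : 1 ≤ n) (hq : 0 ≤ q) (hMn : M * n ≤ T) (hκn : κ ≤ n)
    (hκY : κ ≤ n * (2 * (K * Y))) (hnY : n * (2 * Y) ≤ K) (hMh : M * h = 4 * (T * Y ^ 2)) :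
    κ * (T / n + M) * (1 + T * (2 * q)) + M * (T * q + h * n) ≤
      6 * (K * (T * Y)) + 5 * (T ^ 2 * q) := by
  have hn0 : 0 < n := one_pos.trans_le hn
  have hcycles : T / n + M ≤ 2 * (T / n) := by
    linarith [(le_div_iff₀ hn0).2 hMn]
  have hexplore : κ * (T / n + M) ≤ 4 * (K * (T * Y)) :=
    calc κ * (T / n + M) ≤ n * (2 * (K * Y)) * (2 * (T / n)) := by gcongr; exact hκ.trans hκY
      _ = 4 * (K * (T * Y)) := by field_simp; ring
  have hsteps : κ * (T / n + M) ≤ 2 * T :=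
    calc κ * (T / n + M) ≤ n * (2 * (T / n)) := by gcongr
      _ = 2 * T := by field_simp
  have hfalse : κ * (T / n + M) * (T * (2 * q)) ≤ 4 * (T ^ 2 * q) :=
    calc κ * (T / n + M) * (T * (2 * q)) ≤ 2 * T * (T * (2 * q)) := by gcongr
      _ = 4 * (T ^ 2 * q) := by ring
  have hmiss : M * (T * q) ≤ T ^ 2 * q :=
    calc M * (T * q) ≤ T * (T * q) := by
          gcongr
          exact (le_mul_of_one_le_right hM hn).trans hMn
      _ = T ^ 2 * q := by ring
  have hdelay : M * (h * n) ≤ 2 * (K * (T * Y)) :=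
    calc M * (h * n) = 2 * T * Y * (n * (2 * Y)) := by rw [← mul_assoc, hMh]; ring
      _ ≤ 2 * T * Y * K := by gcongr
      _ = 2 * (K * (T * Y)) := by ring
  linarith

namespace DuelingEnv

variable {K T N : ℕ} {E : DuelingEnv K T N} {O : Fin (K * (K - 1) / 2) ≃ ArmPair K}
  {alg : DuelingAlg K} {γ : ℝ}

theorem mdbRegret_le_of_rate_le_one {h : ℕ} {c Y : ℝ} (hK : 2 ≤ K) (hh : 0 < h) (hc : 0 ≤ c)
    (hY : 0 < Y) (hγY : γ = ((K : ℝ) - 1) * Y) (hγK : γ ≤ ((K : ℝ) - 1) / 2) (hγ1 : γ ≤ 1)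
    (hhY : ((N + 1 : ℕ) : ℝ) * h = 4 * (T * Y ^ 2))
    (hlen : ∀ m, 2 * h * mdbCycle K γ ≤ E.segmentLength m)
    (hchange : ∀ k : Fin N, ∃ a : ArmPair K,
      2 * c ≤ |E.P k.castSucc a.1.1 a.1.2 - E.P k.succ a.1.1 a.1.2|) :
    E.mdbRegret O (2 * h) (h * c) γ alg ≤
      6 * (K * (T * Y)) + 5 * ((T : ℝ) ^ 2 * Real.exp (-(h * c ^ 2))) + E.algRegret alg := by
  have hK1 : (0 : ℝ) < K - 1 := by
    have hK2 : (2 : ℝ) ≤ K := by exact_mod_cast hK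
    linarith
  have hγ : 0 < γ := hγY ▸ mul_pos hK1 hY
  have hcyc := half_le_mdbCycle (K := K) hγ hγ1
  have hcyc1 : 1 ≤ mdbCycle K γ := (by omega : 1 ≤ K).trans (le_mdbCycle hK hγ hγK)
  have hMn : (N + 1) * mdbCycle K γ ≤ T :=
    (Nat.mul_le_mul_left _ (Nat.le_mul_of_pos_left _ (by omega))).trans (E.mul_le_horizon hlen)
  have hT : 0 < T := (Nat.mul_pos N.succ_pos hcyc1).trans_le hMn
  have hκY : ((K * (K - 1) / 2 : ℕ) : ℝ) ≤ mdbCycle K γ * (2 * (K * Y)) :=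
    calc ((K * (K - 1) / 2 : ℕ) : ℝ) ≤ mdbCycle K γ * (2 * γ) := by
          rw [cast_mul_pred_div_two]
          linarith [le_mdbCycle_mul hγ hcyc1]
      _ ≤ mdbCycle K γ * (2 * (K * Y)) := by
          rw [hγY]
          gcongr
          exact sub_le_self _ zero_le_one
  have hnY : mdbCycle K γ * (2 * Y) ≤ (K : ℝ) := by
    refine le_of_mul_le_mul_right ((Eq.le ?_).trans (mdbCycle_mul_le (by omega) hγ)) hK1
    linear_combination (-2 * (mdbCycle K γ : ℝ)) * hγY
  refine (mdbRegret_le hh hc hcyc hlen hchange).trans (add_le_add_left ?_ _)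
  push_cast at hhY
  exact exploration_add_delay_le (by exact_mod_cast hT) (by positivity) hY.le (by positivity)
    (by exact_mod_cast hcyc1) (Real.exp_pos _).le (by exact_mod_cast hMn)
    (by exact_mod_cast hcyc) hκY hnY hhY

theorem mdbRegret_le_of_one_le_rate {w : ℕ} {b Y : ℝ} (hY : 0 ≤ Y)
    (hγY : γ = ((K : ℝ) - 1) * Y) (hγ1 : 1 ≤ γ) :
    E.mdbRegret O w b γ alg ≤ K * (T * Y) + E.algRegret alg := by
  have hγK : γ ≤ K * Y := hγY ▸ mul_le_mul_of_nonneg_right (sub_le_self _ zero_le_one) hY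
  calc E.mdbRegret O w b γ alg ≤ T * 1 := by
        rw [mdbRegret_eq_mdbRegretFrom, mul_one]
        exact mdbRegretFrom_le_horizon E O w b γ alg 0 (MDBState.fresh K 0)
    _ ≤ T * (K * Y) := by gcongr; exact hγ1.trans hγK
    _ = K * (T * Y) := by ring
    _ ≤ K * (T * Y) + E.algRegret alg := le_add_of_nonneg_right (algRegret_nonneg E alg)

theorem mdbRegret_le_mul_sqrt {h : ℕ} {C : ℝ} (hδ : 0 < E.minimalChange)
    (hC : C = Real.log (horizonQuotient T (N + 1 : ℕ) K)) (hC1 : 1 ≤ C) (hh : 0 < h)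
    (hw : 8 * C / E.minimalChange ^ 2 ≤ 2 * h) (hw' : 2 * h ≤ 10 * C / E.minimalChange ^ 2)
    (hγ : γ = ((K : ℝ) - 1) * √((N + 1 : ℕ) * (2 * h) / (8 * T)))
    (hγK : γ ≤ ((K : ℝ) - 1) / 2) (hlen : ∀ m, 2 * h * mdbCycle K γ ≤ E.segmentLength m) :
    E.mdbRegret O (2 * h) (h * √(2 * C / (2 * h))) γ alg ≤
      10 * (K * √((N + 1 : ℕ) * T * C) / E.minimalChange) + E.algRegret alg := by
  have hK := two_le_of_minimalChange_pos hδ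
  have hK0 : (0 : ℝ) < K := by exact_mod_cast two_pos.trans_le hK
  have hT := cast_horizon_pos hδ
  have hh0 : (0 : ℝ) < h := by exact_mod_cast hh
  set Y := √((N + 1 : ℕ) * (2 * h) / (8 * T)) with hY_def
  have hY : 0 < Y := Real.sqrt_pos.2 (by positivity)
  have hrate : K * (T * Y) ≤ 5 / 4 * (K * √((N + 1 : ℕ) * T * C) / E.minimalChange) :=
    calc K * (T * Y) ≤ K * (5 / 4 * (√((N + 1 : ℕ) * T * C) / E.minimalChange)) := by
          refine mul_le_mul_of_nonneg_left ?_ hK0.le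
          exact mul_sqrt_div_le hT (by positivity) (by positivity) (by linarith) hδ hw'
      _ = 5 / 4 * (K * √((N + 1 : ℕ) * T * C) / E.minimalChange) := by ring
  rcases le_total γ 1 with hγ1 | hγ1
  · have herror : (T : ℝ) ^ 2 * Real.exp (-C) ≤
        1 / 2 * (K * √((N + 1 : ℕ) * T * C) / E.minimalChange) :=
      sq_mul_exp_neg_le (by positivity) hK0 hT hC hC1 hδ (minimalChange_le_one hδ)
    have hY2 : ((N + 1 : ℕ) : ℝ) * h = 4 * (T * Y ^ 2) := by
      rw [hY_def, Real.sq_sqrt (by positivity)]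
      field_simp
      norm_num
    have hmain := mdbRegret_le_of_rate_le_one (O := O) (alg := alg) hK hh (Real.sqrt_nonneg _) hY
      hγ hγK hγ1 hY2 hlen fun k => (exists_armPair_minimalChange_le hδ k).imp fun _ ha =>
        (two_mul_sqrt_le hh0 hδ hw).trans ha
    rw [mul_sqrt_sq_eq hh0 (by linarith)] at hmain
    linarith
  · have hmain := mdbRegret_le_of_one_le_rate (E := E) (O := O) (alg := alg) (w := 2 * h)
      (b := h * √(2 * C / (2 * h))) hY.le hγ hγ1
    have hnonneg : 0 ≤ K * √((N + 1 : ℕ) * T * C) / E.minimalChange := by positivity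
    linarith

theorem two_mul_mul_le_horizon {h : ℕ} (hK : 2 ≤ K) (hh : 0 < h) (hγ0 : 0 < γ)
    (hγK : γ ≤ ((K : ℝ) - 1) / 2) (hlen : ∀ m, 2 * h * mdbCycle K γ ≤ E.segmentLength m) :
    2 * ((N + 1 : ℕ) : ℝ) * K ≤ T := by
  have hcyc := le_mdbCycle hK hγ0 hγK
  have hL : 2 * (N + 1) * K ≤ T :=
    calc 2 * (N + 1) * K = (N + 1) * (2 * 1 * K) := by ring
      _ ≤ (N + 1) * (2 * h * mdbCycle K γ) := by gcongr; exact hh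
      _ ≤ T := E.mul_le_horizon hlen
  exact_mod_cast hL

end DuelingEnv

theorem corollary1_general {K T N : ℕ} (E : DuelingEnv K T N)
    (O : Fin (K * (K - 1) / 2) ≃ ArmPair K) (alg : DuelingAlg K) {M w : ℕ} {δ C γ b c : ℝ}
    (hM : M = N + 1) (hδ : δ = E.minimalChange) (hδ0 : 0 < δ)
    (hC : C = Real.log (√(2 * (T : ℝ)) * (2 * (T : ℝ) + 1) / (√(M : ℝ) * (K : ℝ))))
    (hw : IsLeast {v : ℕ | Even v ∧ 8 * C / δ ^ 2 ≤ (v : ℝ)} w)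
    (hγ : γ = ((K : ℝ) - 1) * √((M : ℝ) * (w : ℝ) / (8 * (T : ℝ))))
    (hb : b = √((w : ℝ) * C / 2)) (hc : c = √(2 * C / (w : ℝ)))
    (hlen : ∀ m, w * mdbCycle K γ ≤ E.segmentLength m)
    (hγ0 : 0 < γ) (hγK : γ ≤ ((K : ℝ) - 1) / 2) :
    (0 < b ∧ 0 < c ∧ 2 * b / (w : ℝ) + c ≤ δ) ∧
    E.mdbRegret O w b γ alg ≤
      10 * ((K : ℝ) * √((M : ℝ) * (T : ℝ) * C) / δ) + E.algRegret alg ∧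
    ∀ ε : ℝ, 0 < ε → (T : ℝ) ^ ε ≤ δ * (T : ℝ) / ((K : ℝ) * (M : ℝ)) →
      E.mdbRegret O w b γ alg ≤
        10 * √(3 / ε) * ((K : ℝ) *
          √((M : ℝ) * (T : ℝ) * Real.log (δ * (T : ℝ) / ((K : ℝ) * (M : ℝ)))) / δ)
          + E.algRegret alg := by
  subst hM hδ
  obtain ⟨h, rfl⟩ := hw.1.1.two_dvd
  have hT := DuelingEnv.cast_horizon_pos hδ0
  have hh : 0 < h := Nat.pos_of_ne_zero fun h0 => hγ0.ne' (by simp [hγ, h0])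
  have hh0 : (0 : ℝ) < h := by exact_mod_cast hh
  have hK := DuelingEnv.two_le_of_minimalChange_pos hδ0
  have hK1 : (1 : ℝ) ≤ K := by exact_mod_cast one_le_two.trans hK
  have hM1 : (1 : ℝ) ≤ (N + 1 : ℕ) := by exact_mod_cast N.succ_pos
  have hMK := DuelingEnv.two_mul_mul_le_horizon hK hh hγ0 hγK hlen
  obtain ⟨hC1, hC3⟩ := log_horizonQuotient_mem_Icc hM1 (by exact_mod_cast hK) hMK
  rw [← horizonQuotient] at hC
  rw [← hC] at hC1 hC3
  have hw' := isLeast_even_le (by positivity) hw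
  have hwδ : 8 * C / E.minimalChange ^ 2 + 2 ≤ 10 * C / E.minimalChange ^ 2 := by
    rw [← le_sub_iff_add_le', ← sub_div, le_div_iff₀ (by positivity)]
    nlinarith [DuelingEnv.minimalChange_le_one hδ0]
  have hw8 := hw.1.2
  push_cast at hw8 hw' hγ hb hc
  rw [sqrt_mul_div_two_eq hh0, ← hc] at hb
  have hc0 : 0 < c := hc ▸ Real.sqrt_pos.2 (by positivity)
  have hmain := DuelingEnv.mdbRegret_le_mul_sqrt (O := O) (alg := alg) hδ0 hC hC1 hh hw8
    (hw'.trans hwδ) (by push_cast; exact hγ) hγK hlen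
  rw [← hc, ← hb] at hmain
  refine ⟨⟨hb ▸ mul_pos hh0 hc0, hc0, ?_⟩, hmain, fun ε hε hy => hmain.trans ?_⟩
  · calc 2 * b / (2 * h : ℕ) + c = 2 * c := by rw [hb]; push_cast; field_simp; ring
      _ ≤ E.minimalChange := hc ▸ two_mul_sqrt_le hh0 hδ0 hw8
  · rw [mul_assoc 10]
    refine add_le_add_left (mul_le_mul_of_nonneg_left ?_ (by norm_num)) _
    exact mul_sqrt_log_le hT hε K.cast_nonneg (by positivity) hδ0 hC3 hy

theorem corollary1 :
    ∃ (A : ℝ) (B : ℝ → ℝ),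
      ∀ (K T N : ℕ) (E : DuelingEnv K T N) (O : Fin (K * (K - 1) / 2) ≃ ArmPair K)
        (alg : DuelingAlg K) (M w : ℕ) (δ C γ b c : ℝ),
        2 ≤ K → 1 ≤ N → M = N + 1 →
        δ = E.minimalChange → 0 < δ →
        C = Real.log (Real.sqrt (2 * (T : ℝ)) * (2 * (T : ℝ) + 1) / (Real.sqrt (M : ℝ) * (K : ℝ))) →
        IsLeast {v : ℕ | Even v ∧ 8 * C / δ ^ 2 ≤ (v : ℝ)} w →
        γ = ((K : ℝ) - 1) * Real.sqrt ((M : ℝ) * (w : ℝ) / (8 * (T : ℝ))) →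
        b = Real.sqrt ((w : ℝ) * C / 2) →
        c = Real.sqrt (2 * C / (w : ℝ)) →
        -- every segment has at least `2 L` time steps, where `L` is `w` times the cycle length
        (∀ m, 2 * (w * mdbCycle K γ) ≤ E.segmentLength m) →
        -- the admissible range of the exploration rate
        γ ∈ Set.Icc ((K : ℝ) * ((K : ℝ) - 1) / (2 * (T : ℝ))) (((K : ℝ) - 1) / 2) →
        -- the parameters are admissible for the detection of changes of size `δ`
        (0 < b ∧ 0 < c ∧ 2 * b / (w : ℝ) + c ≤ δ) ∧
        -- the bound with the logarithm `C`, uniformly in all parameters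
        E.mdbRegret O w b γ alg ≤
          A * ((K : ℝ) * Real.sqrt ((M : ℝ) * (T : ℝ) * C) / δ) + E.algRegret alg ∧
        -- the bound with the logarithm `log (δ T / (K M))`
        ∀ ε : ℝ, 0 < ε → (T : ℝ) ^ ε ≤ δ * (T : ℝ) / ((K : ℝ) * (M : ℝ)) →
          E.mdbRegret O w b γ alg ≤
            B ε * ((K : ℝ) * Real.sqrt
              ((M : ℝ) * (T : ℝ) * Real.log (δ * (T : ℝ) / ((K : ℝ) * (M : ℝ)))) / δ)
              + E.algRegret alg := by
  refine ⟨10, fun ε => 10 * √(3 / ε), ?_⟩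
  intro K T N E O alg M w δ C γ b c hK _ hM hδ hδ0 hC hw hγ hb hc hlen hγI
  have hT := DuelingEnv.cast_horizon_pos (hδ ▸ hδ0)
  have hK1 : (1 : ℝ) < K := by exact_mod_cast hK
  have hγ0 : 0 < γ := (div_pos (mul_pos (by linarith) (by linarith)) (by linarith)).trans_le hγI.1
  exact corollary1_general E O alg hM hδ hδ0 hC hw hγ hb hc
    (fun m => (Nat.le_mul_of_pos_left _ two_pos).trans (hlen m)) hγ0 hγI.2
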